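/- Let $\Gamma$ be a discrete group and let $\omega\colon\Gamma\times\Gamma\to U(1)$ be a normalized $2$-cocycle: $\omega(g_0,g_1)\,\omega(g_0g_1,g_2)=\omega(g_1,g_2)\,\omega(g_0,g_1g_2)$ and $\omega(g,e)=\omega(e,g)=1$. Put $\lambda^{(\omega)}_g\delta_h=\omega(g,h)\delta_{gh}$ on $\ell^2(\Gamma)$, let $C^*_{r,\omega}(\Gamma)$ be the $C^*$-algebra generated by the $\lambda^{(\omega)}_g$, and write $\lambda_g$, $C^*_r(\Gamma)$ for $\omega=1$. Let $\delta(\lambda_g)=\lambda_g\otimes\lambda_g$, $\delta^{(\omega)}_l(\lambda^{(\omega)}_g)=\lambda_g\otimes\lambda^{(\omega)}_g$, and $W^{(\omega)}(\delta_h\otimes\delta_k)=\omega(h,k)\,\delta_h\otimes\delta_{hk}$, $W=W^{(1)}$. All tensor products of $C^*$-algebras are minimal. Let $A$ be a $C^*$-algebra, faithfully represented on a Hilbert space $H$, with a continuous coaction $\alpha\colon A\to C^*_r(\Gamma)\otimes A$, i.e. a $*$-homomorphism with $(\iota\otimes\alpha)\alpha=(\delta\otimes\iota)\alpha$ such that the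 linear span of $(C^*_r(\Gamma)\otimes 1)\alpha(A)$ is dense in $C^*_r(\Gamma)\otimes A$. Let $\widetilde{\mathrm{Ad}}{}^{(\omega)}(x)=W^{(\omega)*}(1\otimes x)W^{(\omega)}$ for $x\in C^*_{r,\omega}(\Gamma)$, and let $A\boxtimes C^*_{r,\omega}(\Gamma)$ be the $C^*$-algebra on $\ell^2(\Gamma)\otimes H\otimes\ell^2(\Gamma)$ generated by the products $\alpha(a)_{12}\,\widetilde{\mathrm{Ad}}{}^{(\omega)}(x)_{13}$, $a\in A$, $x\in C^*_{r,\omega}(\Gamma)$. The deformation $A_\omega$ is the fixed point algebra of $A\boxtimes C^*_{r,\overline\omega}(\Gamma)$ under the diagonal coaction $$\alpha(a)_{12}\widetilde{\mathrm{Ad}}{}^{(\overline\omega)}(x)_{13}\mapsto (\delta\otimes\iota)(\alpha(a))_{123}\,(\iota\otimes\widetilde{\mathrm{Ad}}{}^{(\overline\omega)})(\delta^{(\overline\omega)}_l(x))_{124},$$ and it carries the coaction $\alpha_\omega$ of $C^*_r(\Gamma)$ obtained by restricting $$\alpha(a)_{12}\widetilde{\mathrm{Ad}}{}^{(\overline\omega)}(x)_{13}\mapsto(\iota\otimes\alpha)(\alpha(a))_{123}\,\widetilde{\mathrm{Ad}}{}^{(\overline\omega)}(x)_{24}.$$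 For a coaction $\beta$ of $C^*_r(\Gamma)$ on $B\subset B(K)$, the reduced crossed product $C_0(\Gamma)\ltimes_\beta B$ is the $C^*$-algebra on $\ell^2(\Gamma)\otimes K$ generated by the products $\beta(b)(f\otimes 1)$, $b\in B$, $f\in C_0(\Gamma)$. Finally let $$A'_\omega=\{x\in C^*_{r,\omega}(\Gamma)\otimes A : (\iota\otimes\alpha)(x)_{213}=(\delta^{(\omega)}_l\otimes\iota)(x)\},$$ with the coaction given by the restriction of $\delta^{(\omega)}_l\otimes\iota$. Then there is an isomorphism of $C^*$-algebras $$C_0(\Gamma)\ltimes_{\alpha_\omega}A_\omega\;\cong\;C_0(\Gamma)\ltimes_\alpha A .$$ More precisely, $\mathrm{Ad}(W^{(\overline\omega)}_{13})$ maps $A_\omega$ onto $A'_\omega\otimes 1$, and the isomorphism is a composition of isomorphisms $$C_0(\Gamma)\ltimes_{\alpha_\omega}A_\omega\xrightarrow{\ \Theta\ }C_0(\Gamma)\ltimes A'_\omega\xrightarrow{\ \Phi\ }C_0(\Gamma)\ltimes A'_1\xrightarrow{\ \Psi\ }C_0(\Gamma)\ltimes_\alpha A ,$$ where $\Theta$ is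 induced by this identification ($\Theta(y)\otimes1=(1\otimes W^{(\overline\omega)}_{13})\,y\,(1\otimes W^{(\overline\omega)}_{13})^*$), $\Psi$ by the identification of $\alpha(A)$ with $A'_1$ ($z=W_{12}\,\Psi(z)_{13}\,W_{12}^*$ on $\ell^2(\Gamma)\otimes\ell^2(\Gamma)\otimes H$), and $\Phi=\mathrm{Ad}(V_{12})$ for the diagonal unitary $$V(\delta_k\otimes\delta_{k'})=\overline{\omega(k^{-1},k)}\;\omega(k^{-1},k')\;\delta_k\otimes\delta_{k'}\qquad(k,k'\in\Gamma).$$ -/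

import Mathlib

open scoped ZeroAtInfty

noncomputable section

namespace CocycleDeformation

/-! ### Hilbert spaces `ℓ²(I) ⊗ H` and their unitaries -/

/-- The Hilbert space `ℓ²(I) ⊗ H`, realised as the square summable families `I → H`.
The tensor power `ℓ²(Γ)^{⊗ n} ⊗ H` is `L2 (Γ × ⋯ × Γ) H`. -/
abbrev L2 (I : Type*) (H : Type*) [NormedAddCommGroup H] := lp (fun _ : I => H) 2

section Hilbert

variable {I J K H : Type*} [NormedAddCommGroup H]

lemma memL2_iff (f : I → H) : Memℓp f 2 ↔ Summable fun i => ‖f i‖ ^ 2 := by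
  rw [memℓp_gen_iff (by norm_num)]
  simp

lemma summable_L2 (ξ : L2 I H) : Summable fun i => ‖ξ i‖ ^ 2 := (memL2_iff _).1 ξ.2

lemma norm_sq_L2 (ξ : L2 I H) : ‖ξ‖ ^ 2 = ∑' i, ‖ξ i‖ ^ 2 := by
  have h := lp.norm_rpow_eq_tsum (p := 2) (by norm_num) ξ
  simpa using h

variable [InnerProductSpace ℂ H]

/-- The monomial unitary `δ_i ⊗ v ↦ c i • (δ_{e i} ⊗ v)` from `ℓ²(I) ⊗ H` onto `ℓ²(J) ⊗ H`. -/
def mono (e : I ≃ J) (c : I → Circle) : L2 I H ≃ₗᵢ[ℂ] L2 J H where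
  toFun ξ := ⟨fun j => (c (e.symm j) : ℂ) • ξ (e.symm j), by
    refine (memL2_iff _).2 ?_
    simp only [norm_smul, Circle.norm_coe, one_mul]
    exact (e.symm.summable_iff (f := fun i => ‖ξ i‖ ^ 2)).2 (summable_L2 ξ)⟩
  invFun ξ := ⟨fun i => ((c i)⁻¹ : ℂ) • ξ (e i), by
    refine (memL2_iff _).2 ?_
    simp only [norm_smul, norm_inv, Circle.norm_coe, inv_one, one_mul]
    exact (e.summable_iff (f := fun j => ‖ξ j‖ ^ 2)).2 (summable_L2 ξ)⟩
  left_inv ξ := by ext i; simp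
  right_inv ξ := by ext i; simp
  map_add' ξ η := by ext i; exact smul_add _ _ _
  map_smul' a ξ := by ext i; exact smul_comm _ _ _
  norm_map' ξ := by
    refine (sq_eq_sq₀ (norm_nonneg _) (norm_nonneg _)).1 ?_
    rw [norm_sq_L2, norm_sq_L2, ← e.symm.tsum_eq]
    refine tsum_congr fun j => ?_
    change ‖(c (e.symm j) : ℂ) • ξ (e.symm j)‖ ^ 2 = _
    rw [norm_smul, Circle.norm_coe, one_mul]

@[simp] lemma mono_apply (e : I ≃ J) (c : I → Circle) (ξ : L2 I H) (j : J) :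
    mono e c ξ j = (c (e.symm j) : ℂ) • ξ (e.symm j) := rfl

@[simp] lemma mono_symm_apply (e : I ≃ J) (c : I → Circle) (ξ : L2 J H) (i : I) :
    (mono e c).symm ξ i = ((c i)⁻¹ : ℂ) • ξ (e i) := rfl

lemma memL2_comp {H' : Type*} [NormedAddCommGroup H'] [InnerProductSpace ℂ H'] (b : H →L[ℂ] H')
    (ξ : L2 K H) :
    (∀ k, ‖b (ξ k)‖ ^ 2 ≤ ‖b‖ ^ 2 * ‖ξ k‖ ^ 2) ∧ Summable fun k => ‖b (ξ k)‖ ^ 2 := by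
  have hle : ∀ k, ‖b (ξ k)‖ ^ 2 ≤ ‖b‖ ^ 2 * ‖ξ k‖ ^ 2 := fun k => by
    rw [← mul_pow]
    have := b.le_opNorm (ξ k)
    gcongr
  exact ⟨hle, Summable.of_nonneg_of_le (fun _ => by positivity) hle
    ((summable_L2 ξ).mul_left (‖b‖ ^ 2))⟩

/-- The canonical unitary `ℓ²(K × J) ⊗ H = ℓ²(K) ⊗ (ℓ²(J) ⊗ H)`. -/
def curry : L2 (K × J) H ≃ₗᵢ[ℂ] L2 K (L2 J H) where
  toFun ξ := ⟨fun k => ⟨fun j => ξ (k, j), (memL2_iff _).2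
      (((summable_prod_of_nonneg fun _ => sq_nonneg _).1 (summable_L2 ξ)).1 k)⟩, by
    refine (memL2_iff _).2 ?_
    simp only [norm_sq_L2]
    exact ((summable_prod_of_nonneg fun _ => sq_nonneg _).1 (summable_L2 ξ)).2⟩
  invFun ξ := ⟨fun p => ξ p.1 p.2, by
    refine (memL2_iff _).2 ((summable_prod_of_nonneg fun _ => sq_nonneg _).2 ⟨?_, ?_⟩)
    · exact fun k => summable_L2 (ξ k)
    · have h := summable_L2 ξ
      simp only [norm_sq_L2] at h
      exact h⟩
  left_inv ξ := by ext i; rfl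
  right_inv ξ := by ext i; rfl
  map_add' ξ η := by ext i; rfl
  map_smul' a ξ := by ext i; rfl
  norm_map' ξ := by
    refine (sq_eq_sq₀ (norm_nonneg _) (norm_nonneg _)).1 ?_
    rw [norm_sq_L2, norm_sq_L2, (summable_L2 ξ).tsum_prod]
    simp only [norm_sq_L2]
    rfl

@[simp] lemma curry_apply (ξ : L2 (K × J) H) (k : K) (j : J) : curry ξ k j = ξ (k, j) := rfl

@[simp] lemma curry_symm_apply (ξ : L2 K (L2 J H)) (p : K × J) :
    curry.symm ξ p = ξ p.1 p.2 := rfl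

/-! ### Operators on `ℓ²(I) ⊗ H` -/

/-- Conjugation of an operator by a unitary: `T ↦ u T u*`. -/
def Ad {E F : Type*} [NormedAddCommGroup E] [InnerProductSpace ℂ E]
    [NormedAddCommGroup F] [InnerProductSpace ℂ F] (u : E ≃ₗᵢ[ℂ] F) (T : E →L[ℂ] E) : F →L[ℂ] F :=
  (u : E →L[ℂ] F) ∘L T ∘L (u.symm : F →L[ℂ] E)

@[simp] lemma Ad_apply {E F : Type*} [NormedAddCommGroup E] [InnerProductSpace ℂ E]
    [NormedAddCommGroup F] [InnerProductSpace ℂ F] (u : E ≃ₗᵢ[ℂ] F) (T : E →L[ℂ] E) (x : F) :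
    Ad u T x = u (T (u.symm x)) := rfl

lemma Ad_star {E F : Type*} [NormedAddCommGroup E] [InnerProductSpace ℂ E] [CompleteSpace E]
    [NormedAddCommGroup F] [InnerProductSpace ℂ F] [CompleteSpace F] (u : E ≃ₗᵢ[ℂ] F)
    (T : E →L[ℂ] E) : Ad u (star T) = star (Ad u T) :=
  map_star u.conjStarAlgEquiv T

/-- The operator `1 ⊗ b` on `ℓ²(K) ⊗ H`, for `b ∈ B(H)`. -/
def constOp (K : Type*) (b : H →L[ℂ] H) : L2 K H →L[ℂ] L2 K H :=
  LinearMap.mkContinuous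
    { toFun := fun ξ => ⟨fun k => b (ξ k), (memL2_iff _).2 (memL2_comp b ξ).2⟩
      map_add' := fun ξ η => by ext k; exact map_add b _ _
      map_smul' := fun a ξ => by ext k; exact map_smul b _ _ }
    ‖b‖ (fun ξ => by
      refine (sq_le_sq₀ (norm_nonneg _) (by positivity)).1 ?_
      rw [norm_sq_L2, mul_pow, norm_sq_L2, ← tsum_mul_left]
      exact Summable.tsum_le_tsum (memL2_comp b ξ).1 (memL2_comp b ξ).2
        ((summable_L2 ξ).mul_left (‖b‖ ^ 2)))

@[simp] lemma constOp_apply (b : H →L[ℂ] H) (ξ : L2 K H) (k : K) :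
    constOp K b ξ k = b (ξ k) := rfl

lemma constOp_zero : constOp K (0 : H →L[ℂ] H) = 0 := by ext ξ k; rfl

lemma constOp_add (b c : H →L[ℂ] H) : constOp K (b + c) = constOp K b + constOp K c := by
  ext ξ k; rfl

lemma constOp_smul (z : ℂ) (b : H →L[ℂ] H) : constOp K (z • b) = z • constOp K b := by
  ext ξ k; rfl

lemma constOp_mul (b c : H →L[ℂ] H) : constOp K (b * c) = constOp K b * constOp K c := by
  ext ξ k; rfl

lemma constOp_star [CompleteSpace H] (b : H →L[ℂ] H) :
    constOp K (star b) = star (constOp K b) := by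
  rw [ContinuousLinearMap.star_eq_adjoint, ContinuousLinearMap.star_eq_adjoint,
    ContinuousLinearMap.eq_adjoint_iff]
  intro ξ η
  simp [lp.inner_eq_tsum, ContinuousLinearMap.adjoint_inner_left]

/-- Multiplication by `f ∈ C₀(Γ)`, acting on the leg of `ℓ²(I)` selected by `p : I → Γ`:
`δ_i ⊗ v ↦ f (p i) • (δ_i ⊗ v)`. -/
def mulC0 {Γ : Type*} [TopologicalSpace Γ] (p : I → Γ) (f : C₀(Γ, ℂ)) :
    L2 I H →L[ℂ] L2 I H :=
  have hf : ∀ i (v : H), ‖f (p i) • v‖ ^ 2 ≤ ‖f‖ ^ 2 * ‖v‖ ^ 2 := fun i v => by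
    have h1 : ‖f (p i)‖ ≤ ‖f‖ := by
      rw [← ZeroAtInftyContinuousMap.norm_toBCF_eq_norm]
      exact f.toBCF.norm_coe_le_norm (p i)
    rw [norm_smul, mul_pow]
    gcongr
  have hs : ∀ ξ : L2 I H, Summable fun i => ‖f (p i) • ξ i‖ ^ 2 := fun ξ =>
    Summable.of_nonneg_of_le (fun _ => by positivity) (fun i => hf i (ξ i))
      ((summable_L2 ξ).mul_left (‖f‖ ^ 2))
  LinearMap.mkContinuous
    { toFun := fun ξ => ⟨fun i => f (p i) • ξ i, (memL2_iff _).2 (hs ξ)⟩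
      map_add' := fun ξ η => by ext i; exact smul_add _ _ _
      map_smul' := fun a ξ => by ext i; exact smul_comm _ _ _ }
    ‖f‖ (fun ξ => by
      refine (sq_le_sq₀ (norm_nonneg _) (by positivity)).1 ?_
      rw [norm_sq_L2, mul_pow, norm_sq_L2, ← tsum_mul_left]
      exact Summable.tsum_le_tsum (fun i => hf i (ξ i)) (hs ξ)
        ((summable_L2 ξ).mul_left (‖f‖ ^ 2)))

@[simp] lemma mulC0_apply {Γ : Type*} [TopologicalSpace Γ] (p : I → Γ) (f : C₀(Γ, ℂ))
    (ξ : L2 I H) (i : I) : mulC0 p f ξ i = f (p i) • ξ i := rfl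

/-- The ampliation `T ↦ 1 ⊗ T` from `B(ℓ²(J) ⊗ H)` to `B(ℓ²(K) ⊗ ℓ²(J) ⊗ H)`. -/
def ampl (K : Type*) (T : L2 J H →L[ℂ] L2 J H) : L2 (K × J) H →L[ℂ] L2 (K × J) H :=
  Ad curry.symm (constOp K T)

@[simp] lemma ampl_apply (T : L2 J H →L[ℂ] L2 J H) (ξ : L2 (K × J) H) (q : K × J) :
    ampl K T ξ q = T (curry ξ q.1) q.2 := rfl

/-- The unitary `1 ⊗ u` on `ℓ²(K) ⊗ ℓ²(J) ⊗ H`. -/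
def amplU (K : Type*) (u : L2 J H ≃ₗᵢ[ℂ] L2 J H) : L2 (K × J) H ≃ₗᵢ[ℂ] L2 (K × J) H where
  toFun ξ := ampl K (u : L2 J H →L[ℂ] L2 J H) ξ
  invFun ξ := ampl K (u.symm : L2 J H →L[ℂ] L2 J H) ξ
  left_inv ξ := by
    ext ⟨k, j⟩
    change u.symm (u (curry ξ k)) j = ξ (k, j)
    rw [u.symm_apply_apply, curry_apply]
  right_inv ξ := by
    ext ⟨k, j⟩
    change u (u.symm (curry ξ k)) j = ξ (k, j)
    rw [u.apply_symm_apply, curry_apply]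
  map_add' ξ η := map_add _ _ _
  map_smul' a ξ := map_smul _ _ _
  norm_map' ξ := by
    change ‖curry.symm (constOp K (u : L2 J H →L[ℂ] L2 J H) (curry ξ))‖ = ‖ξ‖
    rw [LinearIsometryEquiv.norm_map, ← curry.norm_map ξ]
    refine (sq_eq_sq₀ (norm_nonneg _) (norm_nonneg _)).1 ?_
    rw [norm_sq_L2, norm_sq_L2]
    refine tsum_congr fun k => ?_
    change ‖u (curry ξ k)‖ ^ 2 = _
    rw [u.norm_map]

@[simp] lemma amplU_apply (u : L2 J H ≃ₗᵢ[ℂ] L2 J H) (ξ : L2 (K × J) H) (q : K × J) :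
    amplU K u ξ q = u (curry ξ q.1) q.2 := rfl

@[simp] lemma amplU_symm_apply (u : L2 J H ≃ₗᵢ[ℂ] L2 J H) (ξ : L2 (K × J) H) (q : K × J) :
    (amplU K u).symm ξ q = u.symm (curry ξ q.1) q.2 := rfl

lemma ampl_star [CompleteSpace H] (T : L2 J H →L[ℂ] L2 J H) :
    ampl K (star T) = star (ampl K T) := by
  rw [ampl, ampl, constOp_star, Ad_star]

/-- Leg numbering: `T ∈ B(ℓ²(J) ⊗ H)` acting on those legs of `ℓ²(I) ⊗ H` which form the factor
`J` under an identification `K × J ≃ I` (and on `H`), and trivially on the legs which form `K`. -/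
def leg (e : K × J ≃ I) (T : L2 J H →L[ℂ] L2 J H) : L2 I H →L[ℂ] L2 I H :=
  Ad (mono e 1) (ampl K T)

/-- The operator `T ∈ B(ℓ²(J) ⊗ H)` acting on the first leg and on `H` in
`ℓ²(J) ⊗ ℓ²(K) ⊗ H`. -/
def amplRight (K : Type*) (T : L2 J H →L[ℂ] L2 J H) : L2 (J × K) H →L[ℂ] L2 (J × K) H :=
  leg (Equiv.prodComm K J) T

end Hilbert

/-! ### Cocycles and twisted reduced group algebras -/

section Group

variable {Γ : Type*} [Group Γ]

/-- Normalised `U(1)`-valued `2`-cocycles on `Γ`. -/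
structure IsCocycle (ω : Γ → Γ → Circle) : Prop where
  cocycle : ∀ g₀ g₁ g₂, ω g₀ g₁ * ω (g₀ * g₁) g₂ = ω g₁ g₂ * ω g₀ (g₁ * g₂)
  right_one : ∀ g, ω g 1 = 1
  one_left : ∀ g, ω 1 g = 1

section Operators

variable {H : Type*} [NormedAddCommGroup H] [InnerProductSpace ℂ H]

/-- The operator `λ^{(ω)}_g ⊗ 1_H`, where `λ^{(ω)}_g δ_h = ω(g, h) δ_{g h}`. -/
def lam (H : Type*) [NormedAddCommGroup H] [InnerProductSpace ℂ H] (ω : Γ → Γ → Circle) (g : Γ) :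
    L2 Γ H →L[ℂ] L2 Γ H :=
  ((mono (Equiv.mulLeft g) (ω g) : L2 Γ H ≃ₗᵢ[ℂ] L2 Γ H) : L2 Γ H →L[ℂ] L2 Γ H)

lemma lam_apply (ω : Γ → Γ → Circle) (g : Γ) (ξ : L2 Γ H) (h : Γ) :
    lam H ω g ξ h = (ω g (g⁻¹ * h) : ℂ) • ξ (g⁻¹ * h) := rfl

/-- The unitary `∑_i λ_{p(i)} ⊗ δ_i : δ_j ⊗ δ_i ↦ δ_{p(i) j} ⊗ δ_i` on `ℓ²(Γ) ⊗ ℓ²(I) ⊗ H`.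
For `I = Γ` and `p = id` it is the dual fundamental unitary `∑_g λ_g ⊗ δ_g`. -/
def dualW {I : Type*} (p : I → Γ) : L2 (Γ × I) H ≃ₗᵢ[ℂ] L2 (Γ × I) H :=
  mono
    { toFun := fun q => (p q.2 * q.1, q.2)
      invFun := fun q => ((p q.2)⁻¹ * q.1, q.2)
      left_inv := fun q => by simp
      right_inv := fun q => by simp } 1

/-- The map `T ↦ Ŵ (1 ⊗ T) Ŵ*` from `B(ℓ²(I) ⊗ H)` to `B(ℓ²(Γ) ⊗ ℓ²(I) ⊗ H)`, where
`Ŵ = ∑_i λ_{p(i)} ⊗ δ_i`.  For `I = Γ` and `p = id` it sends `λ^{(ω)}_g ⊗ b` to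
`λ_g ⊗ λ^{(ω)}_g ⊗ b` (see `coact_lam`), so that it restricts to `δ ⊗ ι` on `C*_r(Γ) ⊗ A` and to
`δ^{(ω)}_l ⊗ ι` on `C*_{r,ω}(Γ) ⊗ A`. -/
def coact {I : Type*} (p : I → Γ) (T : L2 I H →L[ℂ] L2 I H) :
    L2 (Γ × I) H →L[ℂ] L2 (Γ × I) H :=
  Ad (dualW p) (ampl Γ T)

lemma coact_apply {I : Type*} (p : I → Γ) (T : L2 I H →L[ℂ] L2 I H) :
    coact p T = Ad (dualW p) (ampl Γ T) := rfl

/-- The unitary `W^{(ω)} : δ_h ⊗ δ_k ↦ ω(h, k) δ_h ⊗ δ_{h k}` on `ℓ²(Γ) ⊗ ℓ²(Γ) ⊗ H`, that is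
`W^{(ω)} = ∑_h δ_h ⊗ λ^{(ω)}_h`.  For `ω = 1` it is the fundamental unitary `W`. -/
def regW (ω : Γ → Γ → Circle) : L2 (Γ × Γ) H ≃ₗᵢ[ℂ] L2 (Γ × Γ) H :=
  mono
    { toFun := fun q => (q.1, q.1 * q.2)
      invFun := fun q => (q.1, q.1⁻¹ * q.2)
      left_inv := fun q => by simp
      right_inv := fun q => by simp } (fun q => ω q.1 q.2)

/-- The operator `∑_h δ_h ⊗ Ad^{(ω)}_{h⁻¹}(x) = W^{(ω)*} (1 ⊗ x) W^{(ω)}` on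
`ℓ²(Γ) ⊗ ℓ²(Γ) ⊗ H`. -/
def adTilde (ω : Γ → Γ → Circle) (x : L2 Γ H →L[ℂ] L2 Γ H) :
    L2 (Γ × Γ) H →L[ℂ] L2 (Γ × Γ) H :=
  Ad (regW ω).symm (ampl Γ x)

/-- The unitary `V : δ_k ⊗ δ_{k'} ↦ conj(ω(k⁻¹, k)) ω(k⁻¹, k') δ_k ⊗ δ_{k'}` on
`ℓ²(Γ) ⊗ ℓ²(Γ) ⊗ H`. -/
def diagV (ω : Γ → Γ → Circle) : L2 (Γ × Γ) H ≃ₗᵢ[ℂ] L2 (Γ × Γ) H :=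
  mono (Equiv.refl _) (fun q => (ω q.1⁻¹ q.1)⁻¹ * ω q.1⁻¹ q.2)

/-- `δ^{(ω)}_l ⊗ ι : λ^{(ω)}_g ⊗ b ↦ λ_g ⊗ λ^{(ω)}_g ⊗ b`. -/
lemma coact_lam (ω : Γ → Γ → Circle) (g : Γ) (b : H →L[ℂ] H) (ξ : L2 (Γ × Γ) H) (j k : Γ) :
    coact id (lam H ω g * constOp Γ b) ξ (j, k) =
      (ω g (g⁻¹ * k) : ℂ) • b (ξ (g⁻¹ * j, g⁻¹ * k)) := by
  simp [coact, dualW, lam_apply, mul_assoc]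

/-! ### The diagonal coaction -/

/-- Operators on `ℓ²(Γ) ⊗ ℓ²(Γ) ⊗ H` as operators on the legs one and two of `ℓ²(Γ)^{⊗ 3} ⊗ H`
(and on `H`). -/
def leg₁₂ (T : L2 (Γ × Γ) H →L[ℂ] L2 (Γ × Γ) H) :
    L2 (Γ × Γ × Γ) H →L[ℂ] L2 (Γ × Γ × Γ) H :=
  leg
    { toFun := fun q : Γ × Γ × Γ => (q.2.1, q.2.2, q.1)
      invFun := fun q => (q.2.2, q.1, q.2.1)
      left_inv := fun _ => rfl
      right_inv := fun _ => rfl } T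

/-- Operators on `ℓ²(Γ) ⊗ ℓ²(Γ) ⊗ H` as operators on the legs one and three of
`ℓ²(Γ)^{⊗ 3} ⊗ H` (and on `H`). -/
def leg₁₃ (T : L2 (Γ × Γ) H →L[ℂ] L2 (Γ × Γ) H) :
    L2 (Γ × Γ × Γ) H →L[ℂ] L2 (Γ × Γ × Γ) H :=
  leg
    { toFun := fun q : Γ × Γ × Γ => (q.2.1, q.1, q.2.2)
      invFun := fun q => (q.2.1, q.1, q.2.2)
      left_inv := fun _ => rfl
      right_inv := fun _ => rfl } T

/-- The diagonal coaction `α ⊗ δ^{(ω)}_l` on `A ⊠ C*_{r,ω}(Γ)`, implemented by the unitary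
`δ_j ⊗ δ_k ⊗ δ_m ↦ δ_{k m j} ⊗ δ_k ⊗ δ_m`.  The next two lemmas say that on the generators
`α(a)_{12} Ad~(x)_{13}` it is given by the defining formula
`(δ ⊗ ι)(α(a)) · (ι ⊗ Ad~)(δ^{(ω)}_l(x))` on the appropriate legs. -/
def diagonalCoaction (T : L2 (Γ × Γ) H →L[ℂ] L2 (Γ × Γ) H) :
    L2 (Γ × Γ × Γ) H →L[ℂ] L2 (Γ × Γ × Γ) H :=
  coact (fun q => q.1 * q.2) T

lemma diagonalCoaction_amplRight (T : L2 Γ H →L[ℂ] L2 Γ H) :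
    diagonalCoaction (amplRight Γ T) = leg₁₂ (coact id T) := by
  ext ξ ⟨j, k, m⟩
  simp only [diagonalCoaction, leg₁₂, coact, dualW, amplRight, leg, Ad_apply, mono_apply,
    ampl_apply, Pi.one_apply, Circle.coe_one, one_smul, Equiv.coe_fn_symm_mk, id_eq,
    Equiv.prodComm_symm, Equiv.prodComm_apply, Prod.swap]
  refine congrArg (fun η : L2 Γ H => T η k) ?_
  ext n
  simp [mul_assoc]

lemma diagonalCoaction_adTilde (ω : Γ → Γ → Circle) (x : L2 Γ H →L[ℂ] L2 Γ H) :
    diagonalCoaction (adTilde ω x) =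
      Ad (amplU Γ (regW ω)).symm (leg₁₃ (coact id x)) := by
  ext ξ ⟨j, k, m⟩
  simp [diagonalCoaction, leg₁₃, coact, dualW, leg, adTilde, regW]
  refine congrArg (fun η : L2 Γ H => x η (k * m)) ?_
  ext n
  simp [mul_assoc]

/-- The diagonal coaction is multiplicative. -/
lemma diagonalCoaction_mul (S T : L2 (Γ × Γ) H →L[ℂ] L2 (Γ × Γ) H) :
    diagonalCoaction (S * T) = diagonalCoaction S * diagonalCoaction T := by
  ext ξ q
  simp [diagonalCoaction, coact, ampl, constOp_mul]

/-- The coaction `α_ω`, implemented by the dual fundamental unitary `∑_g λ_g ⊗ δ_g` on the new leg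
and on the first leg of `ℓ²(Γ) ⊗ H ⊗ ℓ²(Γ)`.  The next two lemmas say that on the generators
`α(a)_{12} Ad~(x)_{13}` it is given by the defining formula
`((ι ⊗ α) α(a))_{123} Ad~(x)_{24}`, where `(ι ⊗ α) α = (δ ⊗ ι) α`. -/
def deformedCoaction (T : L2 (Γ × Γ) H →L[ℂ] L2 (Γ × Γ) H) :
    L2 (Γ × Γ × Γ) H →L[ℂ] L2 (Γ × Γ × Γ) H :=
  coact Prod.fst T

lemma deformedCoaction_amplRight (T : L2 Γ H →L[ℂ] L2 Γ H) :
    deformedCoaction (amplRight Γ T) = leg₁₂ (coact id T) := by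
  ext ξ ⟨j, k, m⟩
  simp only [deformedCoaction, leg₁₂, coact, dualW, amplRight, leg, Ad_apply, mono_apply,
    ampl_apply, Pi.one_apply, Circle.coe_one, one_smul, Equiv.coe_fn_symm_mk, id_eq,
    Equiv.prodComm_symm, Equiv.prodComm_apply, Prod.swap]
  refine congrArg (fun η : L2 Γ H => T η k) ?_
  ext n
  simp

lemma deformedCoaction_adTilde (ω : Γ → Γ → Circle) (x : L2 Γ H →L[ℂ] L2 Γ H) :
    deformedCoaction (adTilde ω x) = ampl Γ (adTilde ω x) := by
  ext ξ ⟨j, k, m⟩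
  simp only [deformedCoaction, coact, dualW, adTilde, regW, Ad_apply, mono_apply, mono_symm_apply,
    ampl_apply, Pi.one_apply, Circle.coe_one, one_smul, Equiv.coe_fn_symm_mk, Equiv.coe_fn_mk]
  refine congrArg (fun η : L2 Γ H => _ • x η (k * m)) ?_
  ext n
  simp

end Operators

/-! ### Coactions, deformations and crossed products -/

section Algebras

variable {H : Type*} [NormedAddCommGroup H] [InnerProductSpace ℂ H] [CompleteSpace H]
  {A : Type*} [NonUnitalCStarAlgebra A]

/-- The twisted reduced group algebra `C*_{r,ω}(Γ)`, acting on `ℓ²(Γ) ⊗ H` as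
`C*_{r,ω}(Γ) ⊗ 1_H`: the `C*`-algebra generated by the `λ^{(ω)}_g ⊗ 1_H`.
For `ω = 1` this is `C*_r(Γ)`. -/
def twistedGroupAlg (H : Type*) [NormedAddCommGroup H] [InnerProductSpace ℂ H] [CompleteSpace H]
    (ω : Γ → Γ → Circle) : NonUnitalStarSubalgebra ℂ (L2 Γ H →L[ℂ] L2 Γ H) :=
  (NonUnitalStarAlgebra.adjoin ℂ (Set.range (lam H ω))).topologicalClosure

/-- The minimal (spatial) tensor product `C*_{r,ω}(Γ) ⊗ A`, for `A` represented on `H` by `π`: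
the `C*`-algebra generated by the operators `c ⊗ π(a)` on `ℓ²(Γ) ⊗ H`. -/
def tensor (ω : Γ → Γ → Circle) (π : A →⋆ₙₐ[ℂ] (H →L[ℂ] H)) :
    NonUnitalStarSubalgebra ℂ (L2 Γ H →L[ℂ] L2 Γ H) :=
  (NonUnitalStarAlgebra.adjoin ℂ
    {T | ∃ c ∈ twistedGroupAlg H ω, ∃ a : A, T = c * constOp Γ (π a)}).topologicalClosure

open Classical in
/-- `IsSlicewise π φ x S` says that `S = (ι ⊗ φ)(x)`, for an operator `x` on `ℓ²(I) ⊗ H` in a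
minimal tensor product `C ⊗ A` and for `φ : A → B(ℓ²(J) ⊗ H)`: the matrix coefficients `x_{i i'}`
of `x` on the leg `ℓ²(I)` belong to `π(A) = A`, and the corresponding matrix coefficients of `S`
are the operators `φ(x_{i i'})`, which are given through their own coefficients on `ℓ²(J)`. -/
def IsSlicewise {I J : Type*} (π : A →⋆ₙₐ[ℂ] (H →L[ℂ] H))
    (φ : A →⋆ₙₐ[ℂ] (L2 J H →L[ℂ] L2 J H)) (x : L2 I H →L[ℂ] L2 I H)
    (S : L2 (I × J) H →L[ℂ] L2 (I × J) H) : Prop :=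
  ∀ i i' : I, ∃ a : A, (∀ v : H, x (lp.single 2 i' v) i = π a v) ∧
    ∀ (j j' : J) (v : H), S (lp.single 2 (i', j') v) (i, j) = φ a (lp.single 2 j' v) j

/-- Continuous coactions `α : A → C*_r(Γ) ⊗ A` of `C*_r(Γ)` on `A`, where `A` is faithfully
represented on `H` by `π`, and `C*_r(Γ) ⊗ A` acts on `ℓ²(Γ) ⊗ H`. -/
structure IsCoaction (π : A →⋆ₙₐ[ℂ] (H →L[ℂ] H))
    (α : A →⋆ₙₐ[ℂ] (L2 Γ H →L[ℂ] L2 Γ H)) : Prop where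
  mem_tensor : ∀ a, α a ∈ tensor (1 : Γ → Γ → Circle) π
  /-- multiplicativity: `(ι ⊗ α) ∘ α = (δ ⊗ ι) ∘ α` -/
  coassoc : ∀ a, IsSlicewise π α (α a) (coact id (α a))
  /-- cancellation: the span of `C*_r(Γ)_1 α(A)` is dense in `C*_r(Γ) ⊗ A` -/
  cancel : closure (Submodule.span ℂ {T | ∃ c ∈ twistedGroupAlg H (1 : Γ → Γ → Circle),
    ∃ a : A, T = c * α a} : Set (L2 Γ H →L[ℂ] L2 Γ H)) = tensor (1 : Γ → Γ → Circle) π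

/-- The braided tensor product `A ⊠ C*_{r,ω}(Γ)` on `ℓ²(Γ) ⊗ H ⊗ ℓ²(Γ)`, the legs one and three
being the first and the second factor of the index set `Γ × Γ`: the `C*`-algebra generated by the
products `α(a)_{12} Ad~^{(ω)}(x)_{13}`. -/
def braided (α : A →⋆ₙₐ[ℂ] (L2 Γ H →L[ℂ] L2 Γ H)) (ω : Γ → Γ → Circle) :
    NonUnitalStarSubalgebra ℂ (L2 (Γ × Γ) H →L[ℂ] L2 (Γ × Γ) H) :=
  (NonUnitalStarAlgebra.adjoin ℂ {T | ∃ a : A, ∃ x ∈ twistedGroupAlg H ω,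
    T = amplRight Γ (α a) * adTilde ω x}).topologicalClosure

/-- The `ω`-deformation `A_ω`: the fixed points of the diagonal coaction in
`A ⊠ C*_{r,conj ω}(Γ)`. -/
def deformed (α : A →⋆ₙₐ[ℂ] (L2 Γ H →L[ℂ] L2 Γ H)) (ω : Γ → Γ → Circle) :
    NonUnitalStarSubalgebra ℂ (L2 (Γ × Γ) H →L[ℂ] L2 (Γ × Γ) H) where
  carrier := {T | T ∈ braided α ω⁻¹ ∧ diagonalCoaction T = ampl Γ T}
  zero_mem' := ⟨zero_mem _, by ext ξ q; simp [diagonalCoaction, coact, ampl, constOp_zero]⟩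
  add_mem' := by
    rintro S T ⟨hS, hS'⟩ ⟨hT, hT'⟩
    refine ⟨add_mem hS hT, ?_⟩
    have h1 : diagonalCoaction (S + T) = diagonalCoaction S + diagonalCoaction T := by
      ext ξ q; simp [diagonalCoaction, coact, ampl, constOp_add]
    rw [h1, hS', hT']
    ext ξ q; simp
  mul_mem' := by
    rintro S T ⟨hS, hS'⟩ ⟨hT, hT'⟩
    refine ⟨mul_mem hS hT, ?_⟩
    rw [diagonalCoaction_mul, hS', hT']
    ext ξ q; simp [ampl, constOp_mul]
  smul_mem' := by
    rintro c T ⟨hT, hT'⟩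
    refine ⟨SMulMemClass.smul_mem c hT, ?_⟩
    have h1 : diagonalCoaction (c • T) = c • diagonalCoaction T := by
      ext ξ q; simp [diagonalCoaction, coact, ampl, constOp_smul]
    rw [h1, hT']
    ext ξ q; simp
  star_mem' := by
    rintro T ⟨hT, hT'⟩
    refine ⟨star_mem hT, ?_⟩
    rw [ampl_star, ← hT', diagonalCoaction, diagonalCoaction, coact, coact, ampl_star, Ad_star]

/-- The concrete picture `A'_ω` of the deformation: the elements `x` of `C*_{r,ω}(Γ) ⊗ A` with
`(ι ⊗ α)(x)_{213} = (δ^{(ω)}_l ⊗ ι)(x)`. -/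
def deformed' (π : A →⋆ₙₐ[ℂ] (H →L[ℂ] H)) (α : A →⋆ₙₐ[ℂ] (L2 Γ H →L[ℂ] L2 Γ H))
    (ω : Γ → Γ → Circle) : Set (L2 Γ H →L[ℂ] L2 Γ H) :=
  {x | x ∈ tensor ω π ∧ IsSlicewise π α x (Ad (mono (Equiv.prodComm Γ Γ) 1) (coact id x))}

variable [TopologicalSpace Γ]

/-- The crossed product by `C₀(Γ)`: if `S` is the image `β(B) ⊆ B(ℓ²(Γ) ⊗ K)` of a coaction `β`,
this is the `C*`-algebra generated by the products `β(b) (f ⊗ 1_K)` for `b ∈ B`, `f ∈ C₀(Γ)`.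
Here `ℓ²(Γ) ⊗ K = ℓ²(I) ⊗ H`, and `p : I → Γ` is the projection to the leg `ℓ²(Γ)`. -/
def crossedBy {I : Type*} (p : I → Γ) (S : Set (L2 I H →L[ℂ] L2 I H)) :
    NonUnitalStarSubalgebra ℂ (L2 I H →L[ℂ] L2 I H) :=
  (NonUnitalStarAlgebra.adjoin ℂ
    {T | ∃ b ∈ S, ∃ f : C₀(Γ, ℂ), T = b * mulC0 p f}).topologicalClosure

/-- The crossed product `C₀(Γ) ⋉_α A`, on `ℓ²(Γ) ⊗ H`. -/
def crossed (α : A →⋆ₙₐ[ℂ] (L2 Γ H →L[ℂ] L2 Γ H)) :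
    NonUnitalStarSubalgebra ℂ (L2 Γ H →L[ℂ] L2 Γ H) :=
  crossedBy id (Set.range α)

/-- The crossed product `C₀(Γ) ⋉_{α_ω} A_ω`, on `ℓ²(Γ) ⊗ (ℓ²(Γ) ⊗ H ⊗ ℓ²(Γ))`.  The coaction
`α_ω` is `deformedCoaction`. -/
def crossedDeformed (α : A →⋆ₙₐ[ℂ] (L2 Γ H →L[ℂ] L2 Γ H)) (ω : Γ → Γ → Circle) :
    NonUnitalStarSubalgebra ℂ (L2 (Γ × Γ × Γ) H →L[ℂ] L2 (Γ × Γ × Γ) H) :=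
  crossedBy Prod.fst (deformedCoaction '' (deformed α ω : Set _))

/-- The crossed product `C₀(Γ) ⋉ A'_ω`, on `ℓ²(Γ) ⊗ (ℓ²(Γ) ⊗ H)`, where the coaction on `A'_ω` is
the restriction of `δ^{(ω)}_l ⊗ ι`. -/
def crossedDeformed' (π : A →⋆ₙₐ[ℂ] (H →L[ℂ] H)) (α : A →⋆ₙₐ[ℂ] (L2 Γ H →L[ℂ] L2 Γ H))
    (ω : Γ → Γ → Circle) : NonUnitalStarSubalgebra ℂ (L2 (Γ × Γ) H →L[ℂ] L2 (Γ × Γ) H) :=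
  crossedBy Prod.fst (coact id '' deformed' π α ω)

end Algebras

end Group

end CocycleDeformation

end

open CocycleDeformation

/-! A coaction grades `A`: the spectral subspaces are A_g = {a : α(a) = λ_g ⊗ a}. All the algebras
involved are controlled by homogeneous elements, and on these every map of the theorem is a
computation with phases.

The analytic point is that A'_ω is the closed span of the λ^{(ω)}_g ⊗ a with a ∈ A_g
(`mem_deformed'_iff_mem_clSpan`). An element x of C*_{r,ω}(Γ) ⊗ A lies in A'_ω exactly when its
matrix coefficients satisfy x_{ij} ∈ A_{ij⁻¹} (`mem_deformed'_iff`). The map E(x)_{ij} =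
α(x_{ij})_{ij} is contractive (`norm_le_of_diagonal_coeff`), fixes A'_ω, and sends λ^{(ω)}_g ⊗ a to
λ^{(ω)}_g ⊗ a_g, where a_g ∈ A_g is the component of a. Hence E turns an approximation of x ∈ A'_ω
by finite sums into one by homogeneous sums.

Conjugation by W^{(conj ω)}_{13} sends the braided product into the closed span of the λ^{(ω)}_g ⊗
λ^{(conj ω)}_u ⊗ a with a ∈ A_g (`Ad_regW_mem_clSpan_mixed`), and the diagonal coaction to one that
reads the last leg only. Its fixed points are the part u = 1, which is A'_ω ⊗ 1 (`image_deformed`).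

In C₀(Γ) ⋉ A'_ω the twist of a degree g generator is a phase ω(g, ·) on the second leg. By the
cocycle identity `diagV_phase`, Ad(V) moves it to the first leg, where it is absorbed into the
function from C₀(Γ); this untwists the algebra. Finally W (α(a) ⊗ 1) W* = (δ ⊗ ι)α(a), because α(a)
is invariant under right translations (`Ad_regW_one_amplRight`). Each of Θ, Φ, Ψ comes from an
equality of images under injective homomorphisms (`exists_starAlgEquiv`). -/

noncomputable section

namespace CocycleDeformation

/-! ### Algebras generated by multiplicative sets -/

section Generation

variable {E F G : Type*} [NormedAddCommGroup E] [NormedSpace ℂ E] [NormedAddCommGroup F]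
  [NormedSpace ℂ F] [NormedAddCommGroup G] [NormedSpace ℂ G]

/-- The closed linear span. -/
abbrev clSpan (s : Set E) : Submodule ℂ E := (Submodule.span ℂ s).topologicalClosure

lemma subset_clSpan (s : Set E) : s ⊆ clSpan s := fun _ hx =>
  Submodule.le_topologicalClosure _ (Submodule.subset_span hx)

lemma clSpan_le {s : Set E} {N : Submodule ℂ E} (hN : IsClosed (N : Set E)) (h : s ⊆ N) :
    clSpan s ≤ N :=
  Submodule.topologicalClosure_minimal _ (Submodule.span_le.2 h) hN

lemma map_mem_of_mem_clSpan (f : E →L[ℂ] F) {s : Set E} {N : Submodule ℂ F}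
    (hN : IsClosed (N : Set F)) (h : ∀ x ∈ s, f x ∈ N) {x : E} (hx : x ∈ clSpan s) : f x ∈ N :=
  clSpan_le (N := N.comap (f : E →ₗ[ℂ] F)) (hN.preimage f.continuous) h hx

lemma map₂_mem_of_mem_clSpan (f : E →L[ℂ] F →L[ℂ] G) {s : Set E} {t : Set F} {N : Submodule ℂ G}
    (hN : IsClosed (N : Set G)) (h : ∀ x ∈ s, ∀ y ∈ t, f x y ∈ N) {x : E} {y : F}
    (hx : x ∈ clSpan s) (hy : y ∈ clSpan t) : f x y ∈ N := by
  refine map_mem_of_mem_clSpan (f.flip y) hN (fun x' hx' => ?_) hx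
  exact map_mem_of_mem_clSpan (f x') hN (h x' hx') hy

variable {B C D : Type*} [NonUnitalCStarAlgebra B] [NonUnitalCStarAlgebra C]
  [NonUnitalCStarAlgebra D]

/-- The `C*`-algebra generated by `s`. -/
abbrev cstarGen (s : Set B) : NonUnitalStarSubalgebra ℂ B :=
  (NonUnitalStarAlgebra.adjoin ℂ s).topologicalClosure

lemma subset_cstarGen (s : Set B) : s ⊆ cstarGen s := fun _ hx =>
  NonUnitalStarSubalgebra.le_topologicalClosure _ (NonUnitalStarAlgebra.subset_adjoin ℂ s hx)

lemma cstarGen_le {s : Set B} {N : NonUnitalStarSubalgebra ℂ B} (hN : IsClosed (N : Set B))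
    (h : s ⊆ N) : cstarGen s ≤ N :=
  NonUnitalStarSubalgebra.topologicalClosure_minimal _ (NonUnitalStarAlgebra.adjoin_le h) hN

lemma isClosed_cstarGen (s : Set B) : IsClosed ((cstarGen s).toSubmodule : Set B) :=
  NonUnitalStarSubalgebra.isClosed_topologicalClosure _

/-- Words in the generators and their adjoints stay in `s`, so the linear span is already the
generated *-algebra. -/
lemma mem_cstarGen_iff_mem_clSpan {s : Set B} (hmul : ∀ x ∈ s, ∀ y ∈ s, x * y ∈ s)
    (hstar : ∀ x ∈ s, star x ∈ s) {x : B} : x ∈ cstarGen s ↔ x ∈ clSpan s := by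
  have h1 : s ∪ star s = s := Set.union_eq_self_of_subset_right fun y hy => by
    simpa using hstar _ hy
  have h2 : (NonUnitalStarAlgebra.adjoin ℂ s).toSubmodule = Submodule.span ℂ s := by
    rw [NonUnitalStarAlgebra.adjoin_eq_span, h1]
    let M : Subsemigroup B := ⟨s, fun {a b} ha hb => hmul a ha b hb⟩
    exact congrArg _ (congrArg _ (Subsemigroup.closure_eq M))
  change x ∈ closure ((NonUnitalStarAlgebra.adjoin ℂ s).toSubmodule : Set B) ↔ _
  rw [h2]
  rfl

/-- Used to replace the given generators `t` by explicit ones `s` whose products and adjoints can be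
computed. -/
lemma cstarGen_le_of_subset_clSpan {s t : Set B} (hmul : ∀ x ∈ s, ∀ y ∈ s, x * y ∈ s)
    (hstar : ∀ x ∈ s, star x ∈ s) (h : t ⊆ clSpan s) {x : B} (hx : x ∈ cstarGen t) :
    x ∈ clSpan s := by
  rw [← mem_cstarGen_iff_mem_clSpan hmul hstar]
  exact cstarGen_le (isClosed_cstarGen s)
    (fun y hy => (mem_cstarGen_iff_mem_clSpan hmul hstar).2 (h hy)) hx

/-- An injective *-homomorphism of `C*`-algebras is isometric, hence a closed map, so it commutes
with taking closures. -/
lemma map_cstarGen (φ : B →⋆ₙₐ[ℂ] C) (hφ : Function.Injective φ) (s : Set B) :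
    (cstarGen s).map φ = cstarGen (φ '' s) := by
  have h := NonUnitalStarAlgHom.isometry φ hφ
  rw [cstarGen, cstarGen, ← NonUnitalStarAlgHom.map_adjoin,
    NonUnitalStarSubalgebra.topologicalClosure_map _ h.isClosedEmbedding.isClosedMap h.continuous]

lemma mem_cstarGen_image (φ : B →⋆ₙₐ[ℂ] C) (hφ : Function.Injective φ) {s : Set B} {x : B}
    (hx : x ∈ cstarGen s) : φ x ∈ cstarGen (φ '' s) :=
  map_cstarGen φ hφ s ▸ ⟨x, hx, rfl⟩

lemma map_cstarGen_le (φ : B →⋆ₙₐ[ℂ] C) (hφ : Function.Injective φ) {s : Set B}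
    {N : NonUnitalStarSubalgebra ℂ C} (hN : IsClosed (N : Set C)) (h : ∀ x ∈ s, φ x ∈ N) :
    (cstarGen s).map φ ≤ N := by
  rw [map_cstarGen φ hφ]
  refine cstarGen_le hN ?_
  rintro _ ⟨x, hx, rfl⟩
  exact h x hx

lemma map_cstarGen_eq_map_cstarGen (φ : B →⋆ₙₐ[ℂ] D) (ψ : C →⋆ₙₐ[ℂ] D)
    (hφ : Function.Injective φ) (hψ : Function.Injective ψ) {s : Set B} {t : Set C}
    (h : φ '' s = ψ '' t) : (cstarGen s).map φ = (cstarGen t).map ψ := by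
  rw [map_cstarGen φ hφ, map_cstarGen ψ hψ, h]

lemma mem_map_of_eq (φ : B →⋆ₙₐ[ℂ] C) {S : NonUnitalStarSubalgebra ℂ B} {x : B} {y : C}
    (hx : x ∈ S) (h : φ x = y) : y ∈ S.map φ := ⟨x, hx, h⟩

lemma isClosed_map_cstarGen (φ : B →⋆ₙₐ[ℂ] C) (hφ : Function.Injective φ) (s : Set B) :
    IsClosed ((cstarGen s).map φ : Set C) := by
  rw [map_cstarGen φ hφ]
  exact isClosed_cstarGen _

/-- Two subalgebras with the same image under injective homomorphisms are isomorphic. -/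
lemma exists_starAlgEquiv (φ : B →⋆ₙₐ[ℂ] D) (ψ : C →⋆ₙₐ[ℂ] D) (hφ : Function.Injective φ)
    (hψ : Function.Injective ψ) (S : NonUnitalStarSubalgebra ℂ B)
    (T : NonUnitalStarSubalgebra ℂ C) (h : S.map φ = T.map ψ) :
    ∃ e : S ≃⋆ₐ[ℂ] T, ∀ y, φ y.1 = ψ (e y).1 := by
  have h1 : ∀ y : S, ∃ z : T, ψ z.1 = φ y.1 := fun y => by
    have : φ y.1 ∈ T.map ψ := h ▸ ⟨y.1, y.2, rfl⟩
    obtain ⟨z, hz, hz'⟩ := this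
    exact ⟨⟨z, hz⟩, hz'⟩
  have h2 : ∀ z : T, ∃ y : S, φ y.1 = ψ z.1 := fun z => by
    have : ψ z.1 ∈ S.map φ := h ▸ ⟨z.1, z.2, rfl⟩
    obtain ⟨y, hy, hy'⟩ := this
    exact ⟨⟨y, hy⟩, hy'⟩
  choose f hf using h1
  choose g hg using h2
  -- All identities for the new maps are checked inside `D`, after applying `φ` or `ψ`.
  have hψ' : Function.Injective fun z : T => ψ z.1 := hψ.comp Subtype.val_injective
  have hφ' : Function.Injective fun y : S => φ y.1 := hφ.comp Subtype.val_injective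
  refine ⟨{ toFun := f, invFun := g,
            left_inv := fun y => hφ' (by simp only [hg, hf])
            right_inv := fun z => hψ' (by simp only [hg, hf])
            map_mul' := fun x y => hψ' (by simp [hf])
            map_add' := fun x y => hψ' (by simp [hf])
            map_star' := fun x => hψ' (by simp [hf, map_star])
            map_smul' := fun r x => hψ' (by simp [hf]) }, fun y => (hf y).symm⟩

lemma exists_starAlgEquiv_of_map_eq (φ : B →⋆ₙₐ[ℂ] C) (hφ : Function.Injective φ)
    {S : NonUnitalStarSubalgebra ℂ B} {T : NonUnitalStarSubalgebra ℂ C} (h : S.map φ = T) :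
    ∃ e : S ≃⋆ₐ[ℂ] T, ∀ y, φ y.1 = (e y).1 :=
  exists_starAlgEquiv φ (NonUnitalStarAlgHom.id ℂ C) hφ Function.injective_id S T
    (by rw [h, NonUnitalStarSubalgebra.map_id])

lemma exists_starAlgEquiv_of_eq_map (φ : B →⋆ₙₐ[ℂ] C) (hφ : Function.Injective φ)
    {S : NonUnitalStarSubalgebra ℂ B} {T : NonUnitalStarSubalgebra ℂ C} (h : S.map φ = T) :
    ∃ e : T ≃⋆ₐ[ℂ] S, ∀ y, y.1 = φ (e y).1 := by
  obtain ⟨e, he⟩ := exists_starAlgEquiv_of_map_eq φ hφ h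
  exact ⟨e.symm, fun y => by rw [he, StarAlgEquiv.apply_symm_apply]⟩

end Generation

/-! ### Matrix coefficients -/

section Coefficients

variable {I J K H H' : Type*} [NormedAddCommGroup H] [InnerProductSpace ℂ H]
  [NormedAddCommGroup H'] [InnerProductSpace ℂ H']

open Classical in
/-- The isometry `v ↦ δ_i ⊗ v`. -/
def ket (i : I) : H →L[ℂ] L2 I H := lp.singleContinuousLinearMap ℂ (fun _ => H) 2 i

open Classical in
lemma ket_apply (i : I) (v : H) (j : I) : (ket i v : L2 I H) j = if j = i then v else 0 := by
  change Pi.single (M := fun _ => H) i v j = _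
  rw [Pi.single_apply]

lemma single_eq_ket [DecidableEq I] (i : I) (v : H) : lp.single 2 i v = (ket i v : L2 I H) := by
  ext j
  rw [ket_apply, lp.single_apply, Pi.single_apply]
  congr

@[simp] lemma ket_apply_self (i : I) (v : H) : (ket i v : L2 I H) i = v := by
  simp [ket_apply]

lemma ket_apply_ne {i j : I} (h : j ≠ i) (v : H) : (ket i v : L2 I H) j = 0 := by
  simp [ket_apply, h]

lemma norm_ket (i : I) (v : H) : ‖(ket i v : L2 I H)‖ = ‖v‖ := by
  classical
  exact lp.norm_single (E := fun _ : I => H) (p := 2) (by norm_num) i v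

lemma hasSum_ket (ξ : L2 I H) : HasSum (fun i => (ket i (ξ i) : L2 I H)) ξ := by
  classical
  exact lp.hasSum_single (by norm_num) ξ

/-- The evaluation `ξ ↦ ξ i`. -/
def bra (i : I) : L2 I H →L[ℂ] H := lp.evalCLM ℂ (fun _ : I => H) 2 i

@[simp] lemma bra_apply (i : I) (ξ : L2 I H) : bra i ξ = ξ i := rfl

/-- The matrix coefficient `T_{ij}` of an operator. -/
def coeff (i : J) (j : I) : (L2 I H →L[ℂ] L2 J H') →L[ℂ] (H →L[ℂ] H') :=
  (ContinuousLinearMap.compL ℂ H (L2 J H') H' (bra i)).comp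
    ((ContinuousLinearMap.compL ℂ H (L2 I H) (L2 J H')).flip (ket j))

@[simp] lemma coeff_apply (i : J) (j : I) (T : L2 I H →L[ℂ] L2 J H') (v : H) :
    coeff i j T v = T (ket j v) i := rfl

lemma ext_coeff {S T : L2 I H →L[ℂ] L2 J H'} (h : ∀ i j, coeff i j S = coeff i j T) : S = T := by
  classical
  refine lp.ext_continuousLinearMap (by norm_num) fun j => ?_
  ext v i
  exact DFunLike.congr_fun (h i j) v

lemma mono_ket (e : I ≃ J) (c : I → Circle) (i : I) (v : H) :
    mono e c (ket i v) = ket (e i) ((c i : ℂ) • v) := by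
  ext j
  by_cases h : j = e i
  · subst h; simp
  · rw [ket_apply_ne h, mono_apply, ket_apply_ne, smul_zero]
    rintro rfl
    simp at h

lemma mono_symm_ket (e : I ≃ J) (c : I → Circle) (j : J) (v : H) :
    (mono e c).symm (ket j v) = ket (e.symm j) ((c (e.symm j) : ℂ)⁻¹ • v) := by
  rw [LinearIsometryEquiv.symm_apply_eq, mono_ket]
  simp

open Classical in
lemma curry_ket (q : K × J) (v : H) (k : K) :
    curry (ket q v) k = if k = q.1 then (ket q.2 v : L2 J H) else 0 := by
  ext j
  rw [curry_apply, ket_apply]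
  by_cases h : k = q.1
  · simp [h, ket_apply, Prod.ext_iff]
  · simp [h, Prod.ext_iff]

open Classical in
lemma coeff_ampl (T : L2 J H →L[ℂ] L2 J H) (p q : K × J) :
    coeff p q (ampl K T) = if p.1 = q.1 then coeff p.2 q.2 T else 0 := by
  ext v
  rw [coeff_apply, ampl_apply, curry_ket]
  by_cases h : p.1 = q.1 <;> simp [h]

lemma coeff_Ad_mono (e : I ≃ J) (c : I → Circle) (T : L2 I H →L[ℂ] L2 I H) (i j : J) :
    coeff i j (Ad (mono e c) T) =
      ((c (e.symm i) : ℂ) * (c (e.symm j) : ℂ)⁻¹) • coeff (e.symm i) (e.symm j) T := by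
  ext v
  rw [coeff_apply, Ad_apply, mono_symm_ket, mono_apply, map_smul, map_smul,
    smul_apply, mul_smul]
  rfl

end Coefficients

/-! ### Matrix amplifications and Schur multipliers -/

section Matrices

variable {n I H K A : Type*} [Fintype n] [NormedAddCommGroup H] [InnerProductSpace ℂ H]
  [NormedAddCommGroup K] [InnerProductSpace ℂ K] [NonUnitalCStarAlgebra A]

/-- A matrix of operators as an operator. -/
def matOp (M : n → n → (K →L[ℂ] K)) : L2 n K →L[ℂ] L2 n K :=
  ∑ i, ∑ j, (ket i).comp ((M i j).comp (bra j))

lemma matOp_apply (M : n → n → (K →L[ℂ] K)) (ξ : L2 n K) (i : n) :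
    matOp M ξ i = ∑ j, M i j (ξ j) := by
  classical
  rw [← bra_apply, matOp]
  simp only [sum_apply, map_sum, ContinuousLinearMap.comp_apply, bra_apply, ket_apply]
  rw [Finset.sum_eq_single i (fun b _ hb => by simp [hb.symm]) (by simp)]
  simp

lemma star_matOp [CompleteSpace K] (M : n → n → (K →L[ℂ] K)) :
    matOp (fun i j => star (M j i)) = star (matOp M) := by
  rw [ContinuousLinearMap.star_eq_adjoint, ContinuousLinearMap.eq_adjoint_iff]
  intro ξ η
  simp only [lp.inner_eq_tsum, tsum_fintype, matOp_apply, sum_inner, inner_sum,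
    ContinuousLinearMap.star_eq_adjoint, ContinuousLinearMap.adjoint_inner_left]
  exact Finset.sum_comm

/-- The amplification of a representation to matrices. -/
def matRep [CompleteSpace K] (ρ : A →⋆ₙₐ[ℂ] (K →L[ℂ] K)) :
    CStarMatrix n n A →⋆ₙₐ[ℂ] (L2 n K →L[ℂ] L2 n K) where
  toFun M := matOp fun i j => ρ (M i j)
  map_smul' c M := by
    ext ξ i
    simp [matOp_apply, Finset.smul_sum]
  map_zero' := by
    ext ξ i
    simp [matOp_apply]
  map_add' M N := by
    ext ξ i
    simp [matOp_apply, Finset.sum_add_distrib]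
  map_mul' M N := by
    ext ξ i
    change _ = matOp _ (matOp _ ξ) i
    simp only [matOp_apply, CStarMatrix.mul_apply, map_sum, map_mul, sum_apply]
    exact Finset.sum_comm
  map_star' M := by
    rw [← star_matOp]
    simp only [CStarMatrix.star_apply, map_star]

lemma matRep_apply [CompleteSpace K] (ρ : A →⋆ₙₐ[ℂ] (K →L[ℂ] K)) (M : CStarMatrix n n A)
    (ξ : L2 n K) (i : n) : matRep ρ M ξ i = ∑ j, ρ (M i j) (ξ j) := matOp_apply _ ξ i

lemma matRep_injective [CompleteSpace K] (ρ : A →⋆ₙₐ[ℂ] (K →L[ℂ] K))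
    (hρ : Function.Injective ρ) : Function.Injective (matRep (n := n) ρ) := by
  classical
  refine (injective_iff_map_eq_zero _).2 fun M hM => CStarMatrix.ext fun i j => ?_
  refine (map_eq_zero_iff ρ hρ).1 ?_
  ext v
  have h := matRep_apply ρ M (ket j v) i
  rw [hM, Finset.sum_eq_single j (fun b _ hb => by simp [ket_apply_ne hb]) (by simp)] at h
  simpa using h.symm

/-- A faithful representation stays faithful, hence isometric, on matrices, while any other one is
contractive there. This is the complete contractivity needed below. -/
lemma norm_matRep_le [CompleteSpace H] [CompleteSpace K] (π : A →⋆ₙₐ[ℂ] (H →L[ℂ] H))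
    (hπ : Function.Injective π) (ρ : A →⋆ₙₐ[ℂ] (K →L[ℂ] K)) (M : CStarMatrix n n A) :
    ‖matRep ρ M‖ ≤ ‖matRep π M‖ := by
  -- The `C*`-structure on `CStarMatrix` asks for an order on `A`; the spectral order supplies it.
  let _ := CStarAlgebra.spectralOrder A
  have _ := CStarAlgebra.spectralOrderedRing A
  rw [NonUnitalStarAlgHom.norm_map _ (matRep_injective π hπ) M]
  exact NonUnitalStarAlgHom.norm_apply_le _ M

omit [InnerProductSpace ℂ H] [InnerProductSpace ℂ K] in
lemma norm_le_of_norm_apply_le {J : Type*} (ξ : L2 J H) (η : L2 I K) (f : J → I)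
    (hf : Function.Injective f) (h : ∀ j, ‖ξ j‖ ≤ ‖η (f j)‖) : ‖ξ‖ ≤ ‖η‖ := by
  refine (sq_le_sq₀ (norm_nonneg _) (norm_nonneg _)).1 ?_
  rw [norm_sq_L2, norm_sq_L2]
  refine (summable_L2 ξ).tsum_le_tsum_of_inj f hf (fun _ _ => by positivity) (fun j => ?_)
    (summable_L2 η)
  exact pow_le_pow_left₀ (norm_nonneg _) (h j) 2

/-! ### Compression to finite subsets and a contractive Schur-type map -/

/-- Vectors over a finite subset, from vectors on the whole index set. -/
def restrictTo (F : Finset I) (ξ : L2 I H) : L2 F H :=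
  ⟨fun i => ξ i, (memL2_iff _).2 (Summable.of_finite)⟩

omit [InnerProductSpace ℂ H] in
@[simp] lemma restrictTo_apply (F : Finset I) (ξ : L2 I H) (i : F) :
    restrictTo F ξ i = ξ i := rfl

omit [InnerProductSpace ℂ H] in
lemma norm_restrictTo_le (F : Finset I) (ξ : L2 I H) : ‖restrictTo F ξ‖ ≤ ‖ξ‖ :=
  norm_le_of_norm_apply_le _ _ Subtype.val Subtype.val_injective fun _ => le_rfl

/-- The projection onto the vectors supported in a finite subset. -/
def finProj (F : Finset I) : L2 I H →L[ℂ] L2 I H := ∑ i ∈ F, (ket i).comp (bra i)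

open Classical in
lemma finProj_apply (F : Finset I) (ξ : L2 I H) (i : I) :
    finProj F ξ i = if i ∈ F then ξ i else 0 := by
  rw [← bra_apply, finProj]
  simp [ket_apply]

lemma norm_finProj_le (F : Finset I) (ξ : L2 I H) : ‖finProj F ξ‖ ≤ ‖restrictTo F ξ‖ := by
  refine (sq_le_sq₀ (norm_nonneg _) (norm_nonneg _)).1 ?_
  rw [norm_sq_L2, norm_sq_L2]
  change _ ≤ ∑' i : F, ‖ξ i‖ ^ 2
  rw [Finset.tsum_subtype F (fun i => ‖ξ i‖ ^ 2), tsum_eq_sum (s := F)]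
  · exact Finset.sum_le_sum fun i hi => by simp [finProj_apply, hi]
  · intro i hi
    simp [finProj_apply, hi]

lemma tendsto_finProj (ξ : L2 I H) :
    Filter.Tendsto (fun F : Finset I => finProj F ξ) Filter.atTop (nhds ξ) := by
  refine (hasSum_ket ξ).congr fun F => ?_
  simp [finProj]

lemma apply_finProj (T : L2 I H →L[ℂ] L2 I H) (F : Finset I) (ξ : L2 I H) (i : I) :
    T (finProj F ξ) i = ∑ j : F, coeff i j.1 T (ξ j) := by
  rw [Finset.univ_eq_attach, Finset.sum_attach F (fun j => coeff i j T (ξ j)), ← bra_apply]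
  simp [finProj]

/-- The projections P_F tend strongly to 1, so uniform bounds on the finite compressions P_F S P_F
bound S. -/
lemma opNorm_le_of_finProj (S : L2 I H →L[ℂ] L2 I H) {C : ℝ} (hC : 0 ≤ C)
    (h : ∀ (F : Finset I) (ξ : L2 I H), ‖restrictTo F (S (finProj F ξ))‖ ≤ C * ‖ξ‖) :
    ‖S‖ ≤ C := by
  refine S.opNorm_le_bound hC fun ξ => ?_
  have h1 : Filter.Tendsto (fun F : Finset I => ‖finProj F (S ξ)‖ - ‖S (finProj F ξ) - S ξ‖)
      Filter.atTop (nhds (‖S ξ‖ - ‖S ξ - S ξ‖)) :=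
    (tendsto_finProj (S ξ)).norm.sub
      ((((S.continuous.tendsto ξ).comp (tendsto_finProj ξ)).sub_const (S ξ)).norm)
  rw [sub_self, norm_zero, sub_zero] at h1
  refine le_of_tendsto' h1 fun F => ?_
  -- Replacing ξ by P_F ξ costs at most ‖S P_F ξ - S ξ‖, exactly the term subtracted in `h1`.
  have h2 : finProj F (S ξ) = finProj F (S (finProj F ξ)) - finProj F (S (finProj F ξ) - S ξ) := by
    rw [map_sub, sub_sub_cancel]
  have h3 := norm_sub_le (finProj F (S (finProj F ξ))) (finProj F (S (finProj F ξ) - S ξ))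
  rw [← h2] at h3
  have h4 := (norm_finProj_le F (S (finProj F ξ))).trans (h F ξ)
  have h5 := (norm_finProj_le F (S (finProj F ξ) - S ξ)).trans (norm_restrictTo_le F _)
  linarith

/-- The vector `∑ δ_i ⊗ δ_i ⊗ ξ_i`. -/
def diagVec (F : Finset I) (ξ : L2 I H) : L2 F (L2 I H) :=
  ⟨fun i => ket i.1 (ξ i), (memL2_iff _).2 (Summable.of_finite)⟩

@[simp] lemma diagVec_apply (F : Finset I) (ξ : L2 I H) (i : F) :
    diagVec F ξ i = ket i.1 (ξ i) := rfl

lemma norm_diagVec_le (F : Finset I) (ξ : L2 I H) : ‖diagVec F ξ‖ ≤ ‖ξ‖ :=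
  norm_le_of_norm_apply_le _ _ Subtype.val Subtype.val_injective fun i => by
    rw [diagVec_apply, norm_ket]

/-- The completely positive contraction `(x_{ij}) ↦ (φ(x_{ij})_{ij})`. -/
lemma norm_le_of_diagonal_coeff [CompleteSpace H] (π : A →⋆ₙₐ[ℂ] (H →L[ℂ] H))
    (hπ : Function.Injective π) (φ : A →⋆ₙₐ[ℂ] (L2 I H →L[ℂ] L2 I H))
    {T S : L2 I H →L[ℂ] L2 I H}
    (h : ∀ i j, ∃ a, coeff i j T = π a ∧ coeff i j S = coeff i j (φ a)) : ‖S‖ ≤ ‖T‖ := by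
  choose a ha hb using h
  refine opNorm_le_of_finProj S (norm_nonneg T) fun F ξ => ?_
  let M : CStarMatrix F F A := CStarMatrix.ofMatrix fun i j => a i j
  -- The operator `matRep π M` is the compression of `T` to the finite set `F`.
  have h1 : ‖matRep π M‖ ≤ ‖T‖ := by
    refine ContinuousLinearMap.opNorm_le_bound _ (norm_nonneg _) fun ζ => ?_
    obtain ⟨η, hη, rfl⟩ : ∃ η : L2 I H, ‖finProj F η‖ ≤ ‖ζ‖ ∧ restrictTo F η = ζ := by
      have h0 : restrictTo F (∑ i : F, (ket i.1 (ζ i) : L2 I H)) = ζ := by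
        classical
        ext i
        rw [restrictTo_apply, ← bra_apply, map_sum,
          Finset.sum_eq_single i (fun b _ hb => ?_) (by simp)]
        · simp
        · rw [bra_apply, ket_apply_ne fun h => hb (Subtype.ext h.symm)]
      exact ⟨_, (norm_finProj_le F _).trans_eq (congrArg _ h0), h0⟩
    have h2 : matRep π M (restrictTo F η) = restrictTo F (T (finProj F η)) := by
      ext i
      rw [matRep_apply, restrictTo_apply, apply_finProj]
      exact Finset.sum_congr rfl fun j _ => by rw [ha]; rfl
    rw [h2]
    refine (norm_restrictTo_le F _).trans ((T.le_opNorm _).trans ?_)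
    gcongr
  -- With D : δ_i ⊗ v ↦ δ_i ⊗ δ_i ⊗ v, the compression of `S` is D* (φ(a_{ij}))_{ij} D: it reads off
  -- the diagonal coordinates (i, i).
  have h3 : ‖restrictTo F (S (finProj F ξ))‖ ≤ ‖matRep φ M (diagVec F ξ)‖ := by
    refine norm_le_of_norm_apply_le _ _ id Function.injective_id fun i => ?_
    have h4 : restrictTo F (S (finProj F ξ)) i = (matRep φ M (diagVec F ξ) i) i.1 := by
      rw [matRep_apply, restrictTo_apply, apply_finProj, ← bra_apply, map_sum]
      exact Finset.sum_congr rfl fun j _ => by rw [hb]; rfl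
    rw [h4]
    exact lp.norm_apply_le_norm (by norm_num) _ _
  calc _ ≤ _ := h3
    _ ≤ ‖matRep φ M‖ * ‖diagVec F ξ‖ := ContinuousLinearMap.le_opNorm _ _
    _ ≤ ‖T‖ * ‖ξ‖ := by
      gcongr
      · exact (norm_matRep_le π hπ φ M).trans h1
      · exact norm_diagVec_le F ξ

end Matrices

/-! ### Ampliations as homomorphisms -/

section Homomorphisms

variable {I J K H : Type*} [NormedAddCommGroup H] [InnerProductSpace ℂ H] [CompleteSpace H]

/-- The homomorphism `b ↦ 1 ⊗ b`. -/
def constHom (K H : Type*) [NormedAddCommGroup H] [InnerProductSpace ℂ H] [CompleteSpace H] :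
    (H →L[ℂ] H) →⋆ₙₐ[ℂ] (L2 K H →L[ℂ] L2 K H) where
  toFun := constOp K
  map_smul' := constOp_smul
  map_zero' := constOp_zero
  map_add' := constOp_add
  map_mul' := constOp_mul
  map_star' := constOp_star

/-- Conjugation by a unitary as a homomorphism. -/
def adHom {E F : Type*} [NormedAddCommGroup E] [InnerProductSpace ℂ E] [CompleteSpace E]
    [NormedAddCommGroup F] [InnerProductSpace ℂ F] [CompleteSpace F] (u : E ≃ₗᵢ[ℂ] F) :
    (E →L[ℂ] E) →⋆ₙₐ[ℂ] (F →L[ℂ] F) where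
  toFun := Ad u
  map_smul' c T := map_smul u.conjStarAlgEquiv c T
  map_zero' := map_zero u.conjStarAlgEquiv
  map_add' := map_add u.conjStarAlgEquiv
  map_mul' := map_mul u.conjStarAlgEquiv
  map_star' := map_star u.conjStarAlgEquiv

lemma adHom_injective {E F : Type*} [NormedAddCommGroup E] [InnerProductSpace ℂ E]
    [CompleteSpace E] [NormedAddCommGroup F] [InnerProductSpace ℂ F] [CompleteSpace F]
    (u : E ≃ₗᵢ[ℂ] F) : Function.Injective (adHom u) :=
  u.conjStarAlgEquiv.injective

/-- The homomorphism `T ↦ 1 ⊗ T`. -/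
def amplHom (K J H : Type*) [NormedAddCommGroup H] [InnerProductSpace ℂ H] [CompleteSpace H] :
    (L2 J H →L[ℂ] L2 J H) →⋆ₙₐ[ℂ] (L2 (K × J) H →L[ℂ] L2 (K × J) H) :=
  (adHom curry.symm).comp (constHom K (L2 J H))

@[simp] lemma amplHom_apply (T : L2 J H →L[ℂ] L2 J H) : amplHom K J H T = ampl K T := rfl

lemma constHom_injective [Nonempty K] : Function.Injective (constHom K H) := by
  refine (injective_iff_map_eq_zero _).2 fun b hb => ?_
  obtain ⟨k⟩ := ‹Nonempty K›
  ext v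
  have h : (constHom K H b) (ket k v) k = 0 := by rw [hb]; rfl
  rwa [show (constHom K H b) (ket k v) k = b ((ket k v : L2 K H) k) from rfl,
    ket_apply_self] at h

lemma amplHom_injective [Nonempty K] : Function.Injective (amplHom K J H) :=
  (adHom_injective _).comp constHom_injective

/-- Leg numbering as a homomorphism. -/
def legHom (e : K × J ≃ I) : (L2 J H →L[ℂ] L2 J H) →⋆ₙₐ[ℂ] (L2 I H →L[ℂ] L2 I H) :=
  (adHom (mono e 1)).comp (amplHom K J H)

lemma legHom_injective [Nonempty K] (e : K × J ≃ I) :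
    Function.Injective (legHom (H := H) e) :=
  (adHom_injective _).comp amplHom_injective

/-- The map `coact p` as a homomorphism. -/
def coactHom {Γ : Type*} [Group Γ] (p : I → Γ) :
    (L2 I H →L[ℂ] L2 I H) →⋆ₙₐ[ℂ] (L2 (Γ × I) H →L[ℂ] L2 (Γ × I) H) :=
  (adHom (dualW p)).comp (amplHom Γ I H)

/-- A homomorphism of `C*`-algebras as a continuous linear map. -/
def toCLM {B C : Type*} [NonUnitalCStarAlgebra B] [NonUnitalCStarAlgebra C]
    (φ : B →⋆ₙₐ[ℂ] C) : B →L[ℂ] C where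
  toFun := φ
  map_add' := map_add φ
  map_smul' := map_smul φ
  cont := AddMonoidHomClass.continuous_of_bound φ 1 fun b => by
    simpa using NonUnitalStarAlgHom.norm_apply_le φ b

lemma hom_mem_of_mem_clSpan {B C : Type*} [NonUnitalCStarAlgebra B]
    [NonUnitalCStarAlgebra C] (φ : B →⋆ₙₐ[ℂ] C) {s : Set B} {N : Submodule ℂ C}
    (hN : IsClosed (N : Set C)) (h : ∀ x ∈ s, φ x ∈ N) {x : B} (hx : x ∈ clSpan s) : φ x ∈ N :=
  map_mem_of_mem_clSpan (toCLM φ) hN h hx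

lemma mul_mem_of_mem_clSpan {B C D : Type*} [NonUnitalCStarAlgebra B]
    [NonUnitalCStarAlgebra C] [NonUnitalCStarAlgebra D] (φ : B →⋆ₙₐ[ℂ] D) (ψ : C →⋆ₙₐ[ℂ] D)
    {s : Set B} {t : Set C} {N : Submodule ℂ D} (hN : IsClosed (N : Set D))
    (h : ∀ x ∈ s, ∀ y ∈ t, φ x * ψ y ∈ N) {x : B} {y : C}
    (hx : x ∈ clSpan s) (hy : y ∈ clSpan t) : φ x * ψ y ∈ N :=
  map₂_mem_of_mem_clSpan ((ContinuousLinearMap.mul ℂ D).bilinearComp (toCLM φ) (toCLM ψ)) hN h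
    hx hy

end Homomorphisms

/-! ### Homogeneous operators -/

section Homogeneous

variable {Γ : Type*} [Group Γ] {H : Type*} [NormedAddCommGroup H] [InnerProductSpace ℂ H]
  {ω : Γ → Γ → Circle}

lemma IsCocycle.inv (hω : IsCocycle ω) : IsCocycle ω⁻¹ where
  cocycle g₀ g₁ g₂ := by
    simp only [Pi.inv_apply, ← mul_inv, hω.cocycle]
  right_one g := by simp [hω.right_one]
  one_left g := by simp [hω.one_left]

lemma isCocycle_one : IsCocycle (1 : Γ → Γ → Circle) where
  cocycle _ _ _ := rfl
  right_one _ := rfl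
  one_left _ := rfl

lemma lam_mul_lam (hω : IsCocycle ω) (g h : Γ) :
    lam H ω g * lam H ω h = (ω g h : ℂ) • lam H ω (g * h) := by
  ext ξ k
  have h1 : (lam H ω g * lam H ω h) ξ k =
      (ω g (g⁻¹ * k) : ℂ) • (ω h (h⁻¹ * (g⁻¹ * k)) : ℂ) • ξ (h⁻¹ * (g⁻¹ * k)) := rfl
  have h2 : ((ω g h : ℂ) • lam H ω (g * h)) ξ k =
      (ω g h : ℂ) • (ω (g * h) ((g * h)⁻¹ * k) : ℂ) • ξ ((g * h)⁻¹ * k) := rfl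
  have h3 : (g * h)⁻¹ * k = h⁻¹ * (g⁻¹ * k) := by group
  have h4 := hω.cocycle g h (h⁻¹ * (g⁻¹ * k))
  rw [mul_inv_cancel_left] at h4
  rw [h1, h2, h3, smul_smul, smul_smul, ← Circle.coe_mul, ← Circle.coe_mul, h4, mul_comm]

lemma lam_one (hω : IsCocycle ω) : lam H ω 1 = 1 := by
  ext ξ k
  simp [lam_apply, hω.one_left]

lemma lam_mul_constOp (g : Γ) (b : H →L[ℂ] H) :
    lam H ω g * constOp Γ b = constOp Γ b * lam H ω g := by
  ext ξ k
  change (ω g (g⁻¹ * k) : ℂ) • b (ξ (g⁻¹ * k)) = b ((ω g (g⁻¹ * k) : ℂ) • ξ (g⁻¹ * k))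
  rw [map_smul]

variable [CompleteSpace H]

lemma star_lam_mul_lam (g : Γ) : star (lam H ω g) * lam H ω g = 1 := by
  rw [lam, ContinuousLinearMap.star_eq_adjoint, LinearIsometryEquiv.adjoint_eq_symm]
  ext ξ : 1
  exact LinearIsometryEquiv.symm_apply_apply _ ξ

lemma lam_mul_star_lam (g : Γ) : lam H ω g * star (lam H ω g) = 1 := by
  rw [lam, ContinuousLinearMap.star_eq_adjoint, LinearIsometryEquiv.adjoint_eq_symm]
  ext ξ : 1
  exact (mono (Equiv.mulLeft g) (ω g) : L2 Γ H ≃ₗᵢ[ℂ] L2 Γ H).apply_symm_apply ξ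

lemma star_lam (hω : IsCocycle ω) (g : Γ) :
    star (lam H ω g) = ((ω g g⁻¹)⁻¹ : ℂ) • lam H ω g⁻¹ := by
  have h : (lam H ω g) * (((ω g g⁻¹)⁻¹ : ℂ) • lam H ω g⁻¹) = 1 := by
    rw [mul_smul_comm, lam_mul_lam hω, mul_inv_cancel, lam_one hω, smul_smul, inv_mul_cancel₀,
      one_smul]
    exact Circle.coe_ne_zero _
  rw [← mul_one (star _), ← h, ← mul_assoc, star_lam_mul_lam, one_mul]

variable {A : Type*} [NonUnitalCStarAlgebra A] (π : A →⋆ₙₐ[ℂ] (H →L[ℂ] H))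

/-- The operator `λ^{(ω)}_g ⊗ a`, as a function of `a`. -/
def gen (ω : Γ → Γ → Circle) (g : Γ) : A →L[ℂ] (L2 Γ H →L[ℂ] L2 Γ H) :=
  (ContinuousLinearMap.mul ℂ _ (lam H ω g)).comp (toCLM ((constHom Γ H).comp π))

lemma gen_eq (ω : Γ → Γ → Circle) (g : Γ) (a : A) :
    gen π ω g a = lam H ω g * constOp Γ (π a) := rfl

lemma gen_apply (ω : Γ → Γ → Circle) (g : Γ) (a : A) (ξ : L2 Γ H) (k : Γ) :
    gen π ω g a ξ k = (ω g (g⁻¹ * k) : ℂ) • π a (ξ (g⁻¹ * k)) := rfl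

open Classical in
lemma coeff_gen (ω : Γ → Γ → Circle) (g : Γ) (a : A) (i j : Γ) :
    coeff i j (gen π ω g a) = if i = g * j then π ((ω g j : ℂ) • a) else 0 := by
  ext v
  rw [coeff_apply, gen_apply, ket_apply]
  by_cases h : i = g * j
  · subst h; simp
  · rw [if_neg h, if_neg (fun h' => h (by rw [← h', mul_inv_cancel_left]))]
    simp

lemma gen_mul_gen (hω : IsCocycle ω) (g h : Γ) (a b : A) :
    gen π ω g a * gen π ω h b = gen π ω (g * h) ((ω g h : ℂ) • (a * b)) := by
  rw [map_smul, gen_eq, gen_eq, gen_eq, mul_assoc, ← mul_assoc (constOp Γ (π a)),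
    ← lam_mul_constOp, mul_assoc, ← mul_assoc, lam_mul_lam hω, smul_mul_assoc, map_mul,
    constOp_mul]

lemma star_gen (hω : IsCocycle ω) (g : Γ) (a : A) :
    star (gen π ω g a) = gen π ω g⁻¹ (((ω g g⁻¹)⁻¹ : ℂ) • star a) := by
  rw [gen_eq, star_mul, star_lam hω, ← constOp_star, ← map_star, mul_smul_comm, map_smul, gen_eq,
    lam_mul_constOp]

lemma mem_twistedGroupAlg (g : Γ) : lam H ω g ∈ twistedGroupAlg H ω :=
  subset_cstarGen _ ⟨g, rfl⟩

lemma mem_clSpan_of_mem_twistedGroupAlg (hω : IsCocycle ω) {c : L2 Γ H →L[ℂ] L2 Γ H}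
    (hc : c ∈ twistedGroupAlg H ω) : c ∈ clSpan (Set.range (lam H ω)) := by
  -- Scalar multiples are included because a product of two operators λ^{(ω)}_g is only a multiple
  -- of a third.
  have h : c ∈ clSpan {T | ∃ (z : ℂ) (g : Γ), T = z • lam H ω g} := by
    refine cstarGen_le_of_subset_clSpan ?_ ?_ ?_ hc
    · rintro _ ⟨z, g, rfl⟩ _ ⟨w, h, rfl⟩
      refine ⟨z * w * ω g h, g * h, ?_⟩
      rw [smul_mul_smul_comm, lam_mul_lam hω, smul_smul]
    · rintro _ ⟨z, g, rfl⟩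
      refine ⟨star z * (ω g g⁻¹ : ℂ)⁻¹, g⁻¹, ?_⟩
      rw [star_smul, star_lam hω, smul_smul]
    · rintro _ ⟨g, rfl⟩
      exact subset_clSpan _ ⟨1, g, (one_smul _ _).symm⟩
  refine clSpan_le (Submodule.isClosed_topologicalClosure _) ?_ h
  rintro _ ⟨z, g, rfl⟩
  exact Submodule.smul_mem _ _ (subset_clSpan _ ⟨g, rfl⟩)

lemma gen_mem_tensor (ω : Γ → Γ → Circle) (g : Γ) (a : A) : gen π ω g a ∈ tensor ω π :=
  subset_cstarGen _ ⟨_, mem_twistedGroupAlg g, a, rfl⟩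

/-- The operators λ^{(ω)}_g ⊗ a form a self-adjoint multiplicative set, as the cocycle phases can be
absorbed into a. -/
lemma mem_clSpan_of_mem_tensor (hω : IsCocycle ω) {x : L2 Γ H →L[ℂ] L2 Γ H}
    (hx : x ∈ tensor ω π) : x ∈ clSpan {T | ∃ g a, T = gen π ω g a} := by
  refine cstarGen_le_of_subset_clSpan ?_ ?_ ?_ hx
  · rintro _ ⟨g, a, rfl⟩ _ ⟨h, b, rfl⟩
    exact ⟨_, _, gen_mul_gen π hω g h a b⟩
  · rintro _ ⟨g, a, rfl⟩
    exact ⟨_, _, star_gen π hω g a⟩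
  · rintro _ ⟨c, hc, a, rfl⟩
    refine map_mem_of_mem_clSpan ((ContinuousLinearMap.mul ℂ _).flip (constOp Γ (π a)))
      (Submodule.isClosed_topologicalClosure _) ?_ (mem_clSpan_of_mem_twistedGroupAlg hω hc)
    rintro _ ⟨g, rfl⟩
    exact subset_clSpan _ ⟨g, a, rfl⟩

/-- Left translations commute with right translations; this is special to the untwisted algebra. -/
lemma coeff_mul_right_of_mem_tensor {x : L2 Γ H →L[ℂ] L2 Γ H}
    (hx : x ∈ tensor (1 : Γ → Γ → Circle) π) (i j u : Γ) :
    coeff (i * u) (j * u) x = coeff i j x := by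
  refine sub_eq_zero.1 ?_
  refine map_mem_of_mem_clSpan (N := ⊥) (coeff (i * u) (j * u) - coeff i j) (by simp) ?_
    (mem_clSpan_of_mem_tensor π isCocycle_one hx)
  rintro _ ⟨g, a, rfl⟩
  have h : i * u = g * (j * u) ↔ i = g * j := by rw [← mul_assoc, mul_left_inj]
  change coeff (i * u) (j * u) (gen π 1 g a) - coeff i j (gen π 1 g a) = 0
  rw [coeff_gen, coeff_gen, sub_eq_zero]
  by_cases h' : i = g * j
  · rw [if_pos h', if_pos (h.2 h')]
    rfl
  · rw [if_neg h', if_neg (mt h.1 h')]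

end Homogeneous

/-! ### Spectral subspaces and the algebra `A'_ω` -/

section Spectral

variable {Γ : Type*} [Group Γ] {H : Type*} [NormedAddCommGroup H] [InnerProductSpace ℂ H]
  [CompleteSpace H] {A : Type*} [NonUnitalCStarAlgebra A] {ω : Γ → Γ → Circle}
  {π : A →⋆ₙₐ[ℂ] (H →L[ℂ] H)} {α : A →⋆ₙₐ[ℂ] (L2 Γ H →L[ℂ] L2 Γ H)}

omit [CompleteSpace H] in
open Classical in
lemma coeff_coact {I : Type*} (p : I → Γ) (T : L2 I H →L[ℂ] L2 I H) (q r : Γ × I) :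
    coeff q r (coact p T) =
      if (p q.2)⁻¹ * q.1 = (p r.2)⁻¹ * r.1 then coeff q.2 r.2 T else 0 := by
  rw [coact, dualW, coeff_Ad_mono, coeff_ampl]
  simp

lemma isSlicewise_iff {I J : Type*} (φ : A →⋆ₙₐ[ℂ] (L2 J H →L[ℂ] L2 J H))
    (x : L2 I H →L[ℂ] L2 I H) (S : L2 (I × J) H →L[ℂ] L2 (I × J) H) :
    IsSlicewise π φ x S ↔ ∀ i i', ∃ a, coeff i i' x = π a ∧
      ∀ j j', coeff (i, j) (i', j') S = coeff j j' (φ a) := by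
  simp only [IsSlicewise, single_eq_ket, ContinuousLinearMap.ext_iff, coeff_apply]

/-- The spectral subspace `{a | α(a) = λ_g ⊗ a}`. -/
def spectral (π : A →⋆ₙₐ[ℂ] (H →L[ℂ] H)) (α : A →⋆ₙₐ[ℂ] (L2 Γ H →L[ℂ] L2 Γ H)) (g : Γ) :
    Submodule ℂ A :=
  LinearMap.eqLocus (toCLM α).toLinearMap (gen π 1 g).toLinearMap

lemma mem_spectral {g : Γ} {a : A} : a ∈ spectral π α g ↔ α a = gen π 1 g a := Iff.rfl

lemma isClosed_spectral (g : Γ) : IsClosed (spectral π α g : Set A) :=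
  isClosed_eq (toCLM α).continuous (gen π 1 g).continuous

lemma mul_mem_spectral {g h : Γ} {a b : A} (ha : a ∈ spectral π α g) (hb : b ∈ spectral π α h) :
    a * b ∈ spectral π α (g * h) := by
  rw [mem_spectral] at *
  rw [map_mul, ha, hb, gen_mul_gen π isCocycle_one]
  simp

lemma star_mem_spectral {g : Γ} {a : A} (ha : a ∈ spectral π α g) :
    star a ∈ spectral π α g⁻¹ := by
  rw [mem_spectral] at *
  rw [map_star, ha, star_gen π isCocycle_one]
  simp

lemma mem_spectral_iff {g : Γ} {a : A} :
    a ∈ spectral π α g ↔ ∀ j j', coeff j j' (α a) = coeff j j' (gen π 1 g a) :=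
  ⟨fun h j j' => by rw [mem_spectral.1 h], fun h => mem_spectral.2 (ext_coeff h)⟩

/-- For fixed i, i', the coefficients of (δ^{(ω)}_l ⊗ ι)(x)_{213} at j, j' are those of λ_{ii'⁻¹} ⊗
x_{ii'}. The defining equation of A'_ω therefore says that α(x_{ii'}) equals this operator. -/
lemma mem_deformed'_iff {x : L2 Γ H →L[ℂ] L2 Γ H} :
    x ∈ deformed' π α ω ↔ x ∈ tensor ω π ∧
      ∀ i i', ∃ a ∈ spectral π α (i * i'⁻¹), coeff i i' x = π a := by
  classical
  refine and_congr_right fun _ => ?_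
  rw [isSlicewise_iff]
  refine forall₂_congr fun i i' => exists_congr fun a => ?_
  rw [and_comm]
  refine and_congr_left fun hx => ?_
  rw [mem_spectral_iff]
  refine forall₂_congr fun j j' => ?_
  rw [eq_comm, coeff_Ad_mono, coeff_gen]
  have h : i⁻¹ * j = i'⁻¹ * j' ↔ j = i * i'⁻¹ * j' := by
    rw [inv_mul_eq_iff_eq_mul, mul_assoc]
  simp [coeff_coact, hx, h]

/-- The homogeneous elements of `A'_ω`. -/
def homogeneous (π : A →⋆ₙₐ[ℂ] (H →L[ℂ] H)) (α : A →⋆ₙₐ[ℂ] (L2 Γ H →L[ℂ] L2 Γ H))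
    (ω : Γ → Γ → Circle) : Set (L2 Γ H →L[ℂ] L2 Γ H) :=
  {T | ∃ g, ∃ a ∈ spectral π α g, T = gen π ω g a}

lemma mem_deformed'_of_mem_clSpan (hπ : Function.Injective π) {x : L2 Γ H →L[ℂ] L2 Γ H}
    (hx : x ∈ clSpan (homogeneous π α ω)) : x ∈ deformed' π α ω := by
  refine mem_deformed'_iff.2 ⟨?_, fun i i' => ?_⟩
  · refine clSpan_le (N := (tensor ω π).toSubmodule) (isClosed_cstarGen _) ?_ hx
    rintro _ ⟨g, a, -, rfl⟩
    exact gen_mem_tensor π ω g a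
  · have hcl : IsClosed (((spectral π α (i * i'⁻¹)).map (toCLM π : A →ₗ[ℂ] (H →L[ℂ] H))) :
        Set (H →L[ℂ] H)) :=
      (NonUnitalStarAlgHom.isometry π hπ).isClosedEmbedding.isClosedMap _ (isClosed_spectral _)
    have h := map_mem_of_mem_clSpan (coeff i i') hcl ?_ hx
    · obtain ⟨a, ha, ha'⟩ := h
      exact ⟨a, ha, ha'.symm⟩
    · rintro _ ⟨g, a, ha, rfl⟩
      rw [coeff_gen]
      split_ifs with h
      · refine ⟨_, ?_, rfl⟩
        rw [h, mul_inv_cancel_right]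
        exact Submodule.smul_mem _ _ ha
      · exact zero_mem _

lemma gen_mem_deformed' (hπ : Function.Injective π) {g : Γ} {a : A} (ha : a ∈ spectral π α g) :
    gen π ω g a ∈ deformed' π α ω :=
  mem_deformed'_of_mem_clSpan hπ (subset_clSpan _ ⟨g, a, ha, rfl⟩)

/-! ### Homogeneous components and their density -/

/-- The coaction takes its values in `A'_1`. -/
lemma IsCoaction.mem_deformed' (hα : IsCoaction π α) (a : A) : α a ∈ deformed' π α 1 := by
  classical
  refine mem_deformed'_iff.2 ⟨hα.mem_tensor a, fun i i' => ?_⟩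
  -- Coassociativity computes α of a coefficient of α(a) through the coefficients of (δ ⊗ ι)α(a).
  obtain ⟨b, hb, hb'⟩ := (isSlicewise_iff _ _ _).1 (hα.coassoc a) i i'
  refine ⟨b, mem_spectral_iff.2 fun j j' => ?_, hb⟩
  rw [← hb', coeff_coact, coeff_gen]
  have h : j⁻¹ * i = j'⁻¹ * i' ↔ j = i * i'⁻¹ * j' := by
    rw [inv_mul_eq_iff_eq_mul, ← mul_assoc, ← mul_inv_eq_iff_eq_mul, eq_mul_inv_iff_mul_eq,
      eq_comm]
  simp only [id, h, Pi.one_apply, Circle.coe_one, one_smul, ← hb]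
  split_ifs with h'
  · obtain ⟨u, rfl⟩ : ∃ u, j' = i' * u := ⟨i'⁻¹ * j', by simp⟩
    rw [h']
    simpa [mul_assoc] using coeff_mul_right_of_mem_tensor π (hα.mem_tensor a) i i' u
  · rfl

/-- `S` is E(y), computed on finite sums by replacing a in λ^{(ω)}_g ⊗ a by its degree g component.
The relation between `y` and `S` is the hypothesis of `norm_le_of_diagonal_coeff`. -/
lemma exists_homogeneous_part (hα : IsCoaction π α) {y : L2 Γ H →L[ℂ] L2 Γ H}
    (hy : y ∈ Submodule.span ℂ {T | ∃ g a, T = gen π ω g a}) :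
    ∃ S ∈ Submodule.span ℂ (homogeneous π α ω),
      ∀ i j, ∃ a, coeff i j y = π a ∧ coeff i j S = coeff i j (α a) := by
  classical
  induction hy using Submodule.span_induction with
  | mem x hx =>
    obtain ⟨g, a, rfl⟩ := hx
    -- The component of degree g is the coefficient of α(a) at (g, 1).
    obtain ⟨b, hb, hb'⟩ := (mem_deformed'_iff.1 (hα.mem_deformed' a)).2 g 1
    rw [inv_one, mul_one] at hb
    refine ⟨gen π ω g b, Submodule.subset_span ⟨g, b, hb, rfl⟩, fun i j => ?_⟩
    rw [coeff_gen, coeff_gen]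
    split_ifs with h
    · refine ⟨_, rfl, ?_⟩
      rw [map_smul, map_smul, map_smul, ← hb', h,
        ← coeff_mul_right_of_mem_tensor π (hα.mem_tensor a) g 1 j, one_mul]
    · exact ⟨0, by simp, by simp⟩
  | zero => exact ⟨0, zero_mem _, fun i j => ⟨0, by simp, by simp⟩⟩
  | add x y _ _ hx hy =>
    obtain ⟨S, hS, hS'⟩ := hx
    obtain ⟨T, hT, hT'⟩ := hy
    refine ⟨S + T, add_mem hS hT, fun i j => ?_⟩
    obtain ⟨a, ha, ha'⟩ := hS' i j
    obtain ⟨b, hb, hb'⟩ := hT' i j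
    exact ⟨a + b, by rw [map_add, map_add, ha, hb], by rw [map_add, map_add, map_add, ha', hb']⟩
  | smul c x _ hx =>
    obtain ⟨S, hS, hS'⟩ := hx
    refine ⟨c • S, Submodule.smul_mem _ _ hS, fun i j => ?_⟩
    obtain ⟨a, ha, ha'⟩ := hS' i j
    exact ⟨c • a, by rw [map_smul, map_smul, ha], by rw [map_smul, map_smul, map_smul, ha']⟩

/-- The homogeneous elements span a dense subspace of `A'_ω`. -/
lemma mem_deformed'_iff_mem_clSpan (hπ : Function.Injective π) (hα : IsCoaction π α)
    (hω : IsCocycle ω) {x : L2 Γ H →L[ℂ] L2 Γ H} :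
    x ∈ deformed' π α ω ↔ x ∈ clSpan (homogeneous π α ω) := by
  classical
  refine ⟨fun hx => ?_, mem_deformed'_of_mem_clSpan hπ⟩
  obtain ⟨hx₁, hx₂⟩ := mem_deformed'_iff.1 hx
  refine Metric.mem_closure_iff.2 fun ε hε => ?_
  obtain ⟨y, hy, hy'⟩ := Metric.mem_closure_iff.1 (mem_clSpan_of_mem_tensor π hω hx₁) ε hε
  obtain ⟨S, hS, hS'⟩ := exists_homogeneous_part hα hy
  refine ⟨S, hS, lt_of_le_of_lt ?_ hy'⟩
  rw [dist_eq_norm, dist_eq_norm]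
  -- As x has homogeneous coefficients, E(x) = x; thus x - S = E(x - y), and contractivity gives the
  -- estimate.
  refine norm_le_of_diagonal_coeff π hπ α fun i j => ?_
  obtain ⟨a, ha, ha'⟩ := hx₂ i j
  obtain ⟨b, hb, hb'⟩ := hS' i j
  refine ⟨a - b, by rw [map_sub, map_sub, ha', hb], ?_⟩
  rw [map_sub, map_sub, map_sub, hb', mem_spectral.1 ha, coeff_gen, ha']
  simp

end Spectral

/-! ### The identification of `A_ω` with `A'_ω` -/

section Identification

variable {Γ : Type*} [Group Γ] {H : Type*} [NormedAddCommGroup H] [InnerProductSpace ℂ H]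

lemma amplRight_apply {J K : Type*} (T : L2 J H →L[ℂ] L2 J H) (ξ : L2 (J × K) H) (j : J) (k : K) :
    amplRight K T ξ (j, k) = T (curry ((mono (Equiv.prodComm K J) 1).symm ξ) k) j := by
  simp [amplRight, leg]

open Classical in
lemma coeff_amplRight {J K : Type*} (T : L2 J H →L[ℂ] L2 J H) (p q : J × K) :
    coeff p q (amplRight K T) = if p.2 = q.2 then coeff p.1 q.1 T else 0 := by
  rw [amplRight, leg, coeff_Ad_mono, coeff_ampl]
  by_cases h : p.2 = q.2 <;> simp [h]

lemma Ad_trans {E F G : Type*} [NormedAddCommGroup E] [InnerProductSpace ℂ E]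
    [NormedAddCommGroup F] [InnerProductSpace ℂ F] [NormedAddCommGroup G] [InnerProductSpace ℂ G]
    (u : E ≃ₗᵢ[ℂ] F) (v : F ≃ₗᵢ[ℂ] G) (T : E →L[ℂ] E) : Ad (u.trans v) T = Ad v (Ad u T) := rfl

lemma Ad_amplU_ampl {J K : Type*} (u : L2 J H ≃ₗᵢ[ℂ] L2 J H) (T : L2 J H →L[ℂ] L2 J H) :
    Ad (amplU K u) (ampl K T) = ampl K (Ad u T) := rfl

lemma Ad_regW_apply (ω : Γ → Γ → Circle) (T : L2 (Γ × Γ) H →L[ℂ] L2 (Γ × Γ) H)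
    (ξ : L2 (Γ × Γ) H) (j k : Γ) :
    Ad (regW ω) T ξ (j, k) = (ω j (j⁻¹ * k) : ℂ) • T ((regW ω).symm ξ) (j, j⁻¹ * k) := rfl

lemma regW_symm_apply (ω : Γ → Γ → Circle) (ξ : L2 (Γ × Γ) H) (j k : Γ) :
    (regW ω).symm ξ (j, k) = ((ω j k : ℂ)⁻¹) • ξ (j, j * k) := rfl

lemma ampl_lam_apply (ω : Γ → Γ → Circle) (u : Γ) (ξ : L2 (Γ × Γ) H) (j k : Γ) :
    ampl Γ (lam H ω u) ξ (j, k) = (ω u (u⁻¹ * k) : ℂ) • ξ (j, u⁻¹ * k) := rfl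

/-- The diagonal coaction shifts the new leg by k m, and `regW` sends δ_k ⊗ δ_m to a multiple of δ_k
⊗ δ_{km}; afterwards the shift depends on the last leg alone. -/
lemma dualW_trans_amplU_regW (ω : Γ → Γ → Circle) :
    (dualW fun q : Γ × Γ => q.1 * q.2).trans (amplU Γ (regW (H := H) ω)) =
      (amplU Γ (regW ω)).trans (dualW Prod.snd) := by
  ext ξ ⟨j, k, m⟩
  simp [dualW, regW]

/-- The deformed coaction reads only the first leg, whose basis vectors `regW` leaves in place. -/
lemma dualW_fst_trans_amplU_regW (ω : Γ → Γ → Circle) :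
    (dualW Prod.fst).trans (amplU Γ (regW (H := H) ω)) =
      (amplU Γ (regW ω)).trans (dualW Prod.fst) := by
  ext ξ ⟨j, k, m⟩
  simp [dualW, regW]

lemma Ad_amplU_regW_diagonalCoaction (ω : Γ → Γ → Circle)
    (T : L2 (Γ × Γ) H →L[ℂ] L2 (Γ × Γ) H) :
    Ad (amplU Γ (regW ω)) (diagonalCoaction T) = coact Prod.snd (Ad (regW ω) T) := by
  rw [diagonalCoaction, coact_apply, coact_apply, ← Ad_amplU_ampl, ← Ad_trans, ← Ad_trans,
    dualW_trans_amplU_regW]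

lemma Ad_amplU_regW_deformedCoaction (ω : Γ → Γ → Circle)
    (T : L2 (Γ × Γ) H →L[ℂ] L2 (Γ × Γ) H) :
    Ad (amplU Γ (regW ω)) (deformedCoaction T) = deformedCoaction (Ad (regW ω) T) := by
  rw [deformedCoaction, deformedCoaction, coact_apply, coact_apply, ← Ad_amplU_ampl, ← Ad_trans,
    ← Ad_trans, dualW_fst_trans_amplU_regW]

lemma Ad_regW_adTilde (ω : Γ → Γ → Circle) (x : L2 Γ H →L[ℂ] L2 Γ H) :
    Ad (regW ω) (adTilde ω x) = ampl Γ x := by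
  ext ξ : 1
  simp [adTilde]

variable [CompleteSpace H]

lemma diagonalCoaction_eq_iff (ω : Γ → Γ → Circle) (T : L2 (Γ × Γ) H →L[ℂ] L2 (Γ × Γ) H) :
    diagonalCoaction T = ampl Γ T ↔
      coact Prod.snd (Ad (regW ω) T) = ampl Γ (Ad (regW ω) T) := by
  rw [← Ad_amplU_regW_diagonalCoaction, ← Ad_amplU_ampl]
  exact (adHom_injective (E := L2 (Γ × Γ × Γ) H) (F := L2 (Γ × Γ × Γ) H)
    (amplU Γ (regW ω))).eq_iff.symm

omit [CompleteSpace H] in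
lemma coact_snd_amplRight (T : L2 Γ H →L[ℂ] L2 Γ H) :
    coact Prod.snd (amplRight Γ T) = ampl Γ (amplRight Γ T) := by
  refine ext_coeff fun p q => ?_
  rw [coeff_coact, coeff_ampl, coeff_amplRight]
  by_cases h : p.2.2 = q.2.2 <;> by_cases h' : p.1 = q.1 <;> simp [h, h']

-- Comparing coefficients with both new indices equal to 1 shows that fixed points are block
-- diagonal in the second leg.
omit [CompleteSpace H] in
lemma coeff_eq_zero_of_coact_snd_eq {y : L2 (Γ × Γ) H →L[ℂ] L2 (Γ × Γ) H}
    (hy : coact Prod.snd y = ampl Γ y) {p q : Γ × Γ} (h : p.2 ≠ q.2) : coeff p q y = 0 := by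
  have h1 := congrArg (coeff ((1 : Γ), p) ((1 : Γ), q)) hy
  rw [coeff_coact, coeff_ampl] at h1
  simpa [h] using h1.symm

/-- The compression to `δ_1` on the second leg. -/
def compress : (L2 (Γ × Γ) H →L[ℂ] L2 (Γ × Γ) H) →L[ℂ] (L2 Γ H →L[ℂ] L2 Γ H) :=
  (coeff (1 : Γ) (1 : Γ)).comp
    (toCLM (adHom ((mono (Equiv.prodComm Γ Γ) 1).symm.trans curry)))

lemma coeff_compress (y : L2 (Γ × Γ) H →L[ℂ] L2 (Γ × Γ) H) (k k' : Γ) :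
    coeff k k' (compress y) = coeff (k, 1) (k', 1) y := by
  classical
  ext v
  have h : curry.symm (ket (1 : Γ) (ket k' v : L2 Γ H)) = ket (1, k') v := by
    rw [LinearIsometryEquiv.symm_apply_eq]
    ext i : 2
    rw [curry_ket, ket_apply]
  change (mono (Equiv.prodComm Γ Γ) 1).symm (y ((mono (Equiv.prodComm Γ Γ) 1)
    (curry.symm (ket (1 : Γ) (ket k' v : L2 Γ H))))) (1, k) = _
  rw [h, mono_ket]
  simp

/-! ### The braided tensor product after conjugation by W^{(conj ω)} -/

variable {A : Type*} [NonUnitalCStarAlgebra A] {ω : Γ → Γ → Circle}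
  {π : A →⋆ₙₐ[ℂ] (H →L[ℂ] H)} {α : A →⋆ₙₐ[ℂ] (L2 Γ H →L[ℂ] L2 Γ H)}

lemma amplRight_gen_apply (g : Γ) (a : A) (ξ : L2 (Γ × Γ) H) (j k : Γ) :
    amplRight Γ (gen π ω g a) ξ (j, k) = (ω g (g⁻¹ * j) : ℂ) • π a (ξ (g⁻¹ * j, k)) := by
  rw [amplRight_apply, gen_apply]
  simp

lemma op_mul_apply {E : Type*} [NormedAddCommGroup E] [InnerProductSpace ℂ E] (S T : E →L[ℂ] E)
    (x : E) : (S * T) x = S (T x) := rfl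

lemma mixed_apply (g u : Γ) (a : A) (ξ : L2 (Γ × Γ) H) (j k : Γ) :
    (amplRight Γ (gen π ω g a) * ampl Γ (lam H ω⁻¹ u)) ξ (j, k) =
      (ω g (g⁻¹ * j) : ℂ) • (((ω u (u⁻¹ * k))⁻¹ : Circle) : ℂ) •
        π a (ξ (g⁻¹ * j, u⁻¹ * k)) := by
  rw [op_mul_apply, amplRight_gen_apply, ampl_lam_apply, map_smul]
  rfl

/-- The cocycle identity for (g, g⁻¹j, j⁻¹k) splits the phase of the conjugated operator into one
factor on each leg. This is where the twist of A'_ω appears. -/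
lemma Ad_regW_amplRight_gen (hω : IsCocycle ω) (g : Γ) (a : A) :
    Ad (regW ω⁻¹) (amplRight Γ (gen π 1 g a)) =
      amplRight Γ (gen π ω g a) * ampl Γ (lam H ω⁻¹ g) := by
  ext ξ ⟨j, k⟩
  have h1 : Ad (regW ω⁻¹) (amplRight Γ (gen π 1 g a)) ξ (j, k) =
      ((ω j (j⁻¹ * k))⁻¹ * ω (g⁻¹ * j) (j⁻¹ * k) : Circle) •
        π a (ξ (g⁻¹ * j, g⁻¹ * k)) := by
    rw [Ad_regW_apply, amplRight_gen_apply, regW_symm_apply, map_smul]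
    simp [mul_assoc, Circle.smul_def, mul_smul]
  have h2 : (amplRight Γ (gen π ω g a) * ampl Γ (lam H ω⁻¹ g)) ξ (j, k) =
      (ω g (g⁻¹ * j) * (ω g (g⁻¹ * k))⁻¹ : Circle) • π a (ξ (g⁻¹ * j, g⁻¹ * k)) := by
    rw [mixed_apply, mul_smul]
    rfl
  have h3 := hω.cocycle g (g⁻¹ * j) (j⁻¹ * k)
  rw [mul_inv_cancel_left, mul_assoc, mul_inv_cancel_left] at h3
  rw [h1, h2, inv_mul_eq_iff_eq_mul.2]
  rw [← mul_assoc, eq_mul_inv_iff_mul_eq, ← h3, mul_comm]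

/-- The operators `λ^{(ω)}_g ⊗ λ^{(conj ω)}_u ⊗ a` for homogeneous `a` of degree `g`. -/
def mixed (π : A →⋆ₙₐ[ℂ] (H →L[ℂ] H)) (α : A →⋆ₙₐ[ℂ] (L2 Γ H →L[ℂ] L2 Γ H))
    (ω : Γ → Γ → Circle) : Set (L2 (Γ × Γ) H →L[ℂ] L2 (Γ × Γ) H) :=
  {T | ∃ g u, ∃ a ∈ spectral π α g, T = amplRight Γ (gen π ω g a) * ampl Γ (lam H ω⁻¹ u)}

lemma ampl_lam_mul_amplRight_gen (g u : Γ) (a : A) :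
    ampl Γ (lam H ω⁻¹ u) * amplRight Γ (gen π ω g a) =
      amplRight Γ (gen π ω g a) * ampl Γ (lam H ω⁻¹ u) := by
  ext ξ ⟨j, k⟩
  rw [mixed_apply, smul_comm]
  refine Eq.trans ?_ (congrArg _ (amplRight_gen_apply g a ξ j (u⁻¹ * k)))
  exact ampl_lam_apply _ _ _ _ _

/-- The homomorphism `T ↦ T ⊗ 1`. -/
def amplRightHom (Γ H : Type*) [NormedAddCommGroup H] [InnerProductSpace ℂ H] [CompleteSpace H] :
    (L2 Γ H →L[ℂ] L2 Γ H) →⋆ₙₐ[ℂ] (L2 (Γ × Γ) H →L[ℂ] L2 (Γ × Γ) H) :=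
  legHom (Equiv.prodComm Γ Γ)

omit [Group Γ] in
@[simp] lemma amplRightHom_apply (T : L2 Γ H →L[ℂ] L2 Γ H) :
    amplRightHom Γ H T = amplRight Γ T := rfl

/-- Conjugation by `W^{(ω)}` as a homomorphism. -/
def regHom (H : Type*) [NormedAddCommGroup H] [InnerProductSpace ℂ H] [CompleteSpace H]
    (ω : Γ → Γ → Circle) :
    (L2 (Γ × Γ) H →L[ℂ] L2 (Γ × Γ) H) →⋆ₙₐ[ℂ] (L2 (Γ × Γ) H →L[ℂ] L2 (Γ × Γ) H) :=
  adHom (regW ω)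

@[simp] lemma regHom_apply (ω : Γ → Γ → Circle) (T : L2 (Γ × Γ) H →L[ℂ] L2 (Γ × Γ) H) :
    regHom H ω T = Ad (regW ω) T := rfl

lemma regHom_injective : Function.Injective (regHom H ω) :=
  adHom_injective (E := L2 (Γ × Γ) H) (F := L2 (Γ × Γ) H) _

omit [Group Γ] in
lemma amplRight_mul (S T : L2 Γ H →L[ℂ] L2 Γ H) :
    amplRight Γ (S * T) = amplRight Γ S * amplRight Γ T := by
  rw [← amplRightHom_apply, map_mul, amplRightHom_apply, amplRightHom_apply]

omit [Group Γ] in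
lemma ampl_mul (S T : L2 Γ H →L[ℂ] L2 Γ H) : ampl Γ (S * T) = ampl Γ S * ampl Γ T :=
  map_mul (amplHom Γ Γ H) S T

omit [Group Γ] in
lemma amplRight_smul (c : ℂ) (T : L2 Γ H →L[ℂ] L2 Γ H) :
    amplRight Γ (c • T) = c • amplRight Γ T := by
  rw [← amplRightHom_apply, map_smul, amplRightHom_apply]

omit [Group Γ] in
lemma ampl_smul (c : ℂ) (T : L2 Γ H →L[ℂ] L2 Γ H) : ampl Γ (c • T) = c • ampl Γ T :=
  map_smul (amplHom Γ Γ H) c T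

omit [Group Γ] in
lemma amplRight_star (T : L2 Γ H →L[ℂ] L2 Γ H) :
    amplRight Γ (star T) = star (amplRight Γ T) := by
  rw [← amplRightHom_apply, map_star, amplRightHom_apply]

lemma smul_mem_mixed (c : ℂ) {T : L2 (Γ × Γ) H →L[ℂ] L2 (Γ × Γ) H} (hT : T ∈ mixed π α ω) :
    c • T ∈ mixed π α ω := by
  obtain ⟨g, u, a, ha, rfl⟩ := hT
  exact ⟨g, u, c • a, Submodule.smul_mem _ _ ha, by
    rw [map_smul, amplRight_smul, smul_mul_assoc]⟩

lemma mul_mem_mixed (hω : IsCocycle ω) {S T : L2 (Γ × Γ) H →L[ℂ] L2 (Γ × Γ) H}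
    (hS : S ∈ mixed π α ω) (hT : T ∈ mixed π α ω) : S * T ∈ mixed π α ω := by
  obtain ⟨g, u, a, ha, rfl⟩ := hS
  obtain ⟨h, v, b, hb, rfl⟩ := hT
  rw [mul_assoc, ← mul_assoc (ampl Γ _), ampl_lam_mul_amplRight_gen, mul_assoc, ← mul_assoc,
    ← ampl_mul, ← amplRight_mul, lam_mul_lam hω.inv, gen_mul_gen π hω, ampl_smul, mul_smul_comm]
  exact smul_mem_mixed _
    ⟨g * h, u * v, _, Submodule.smul_mem _ _ (mul_mem_spectral ha hb), rfl⟩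

lemma star_mem_mixed (hω : IsCocycle ω) {T : L2 (Γ × Γ) H →L[ℂ] L2 (Γ × Γ) H}
    (hT : T ∈ mixed π α ω) : star T ∈ mixed π α ω := by
  obtain ⟨g, u, a, ha, rfl⟩ := hT
  rw [star_mul, ← ampl_star, ← amplRight_star, star_gen π hω, star_lam hω.inv, ampl_smul,
    smul_mul_assoc, ampl_lam_mul_amplRight_gen]
  exact smul_mem_mixed _
    ⟨g⁻¹, u⁻¹, _, Submodule.smul_mem _ _ (star_mem_spectral ha), rfl⟩

/-- The generators of the braided tensor product. -/
def braidedGens (α : A →⋆ₙₐ[ℂ] (L2 Γ H →L[ℂ] L2 Γ H)) (ω : Γ → Γ → Circle) :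
    Set (L2 (Γ × Γ) H →L[ℂ] L2 (Γ × Γ) H) :=
  {T | ∃ a : A, ∃ x ∈ twistedGroupAlg H ω, T = amplRight Γ (α a) * adTilde ω x}

lemma braided_eq (α : A →⋆ₙₐ[ℂ] (L2 Γ H →L[ℂ] L2 Γ H)) (ω : Γ → Γ → Circle) :
    braided α ω = cstarGen (braidedGens α ω) := rfl

/-- By density α(a) may be replaced by λ_g ⊗ b with b ∈ A_g; the factor λ^{(conj ω)}_g that
conjugation creates merges with the one from x. -/
lemma Ad_regW_generator_mem (hω : IsCocycle ω) (hπ : Function.Injective π) (hα : IsCoaction π α)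
    (a : A) {x : L2 Γ H →L[ℂ] L2 Γ H} (hx : x ∈ twistedGroupAlg H ω⁻¹) :
    regHom H ω⁻¹ (amplRight Γ (α a)) * ampl Γ x ∈ clSpan (mixed π α ω) := by
  have h1 := (mem_deformed'_iff_mem_clSpan hπ hα isCocycle_one).1 (hα.mem_deformed' a)
  have h2 := mem_clSpan_of_mem_twistedGroupAlg hω.inv hx
  refine mul_mem_of_mem_clSpan ((regHom H ω⁻¹).comp (amplRightHom Γ H)) (amplHom Γ Γ H)
    (Submodule.isClosed_topologicalClosure _) ?_ h1 h2
  rintro _ ⟨g, b, hb, rfl⟩ _ ⟨u, rfl⟩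
  refine subset_clSpan _ ?_
  rw [NonUnitalStarAlgHom.comp_apply, amplRightHom_apply, regHom_apply, amplHom_apply,
    Ad_regW_amplRight_gen hω, mul_assoc, ← ampl_mul, lam_mul_lam hω.inv, ampl_smul,
    mul_smul_comm]
  exact smul_mem_mixed _ ⟨g, g * u, b, hb, rfl⟩

lemma regHom_braidedGens_subset (hω : IsCocycle ω) (hπ : Function.Injective π)
    (hα : IsCoaction π α) :
    regHom H ω⁻¹ '' braidedGens α ω⁻¹ ⊆ clSpan (mixed π α ω) := by
  rintro _ ⟨_, ⟨a, x, hx, rfl⟩, rfl⟩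
  rw [map_mul, regHom_apply _ (adTilde _ _), Ad_regW_adTilde]
  exact Ad_regW_generator_mem hω hπ hα a hx

lemma regHom_mem_cstarGen {T : L2 (Γ × Γ) H →L[ℂ] L2 (Γ × Γ) H} (hT : T ∈ braided α ω) :
    regHom H ω T ∈ cstarGen (regHom H ω '' braidedGens α ω) := by
  rw [braided_eq] at hT
  exact mem_cstarGen_image (regHom H ω) regHom_injective hT

lemma mem_clSpan_mixed_of_mem_cstarGen (hω : IsCocycle ω)
    {s : Set (L2 (Γ × Γ) H →L[ℂ] L2 (Γ × Γ) H)} (hs : s ⊆ clSpan (mixed π α ω))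
    {y : L2 (Γ × Γ) H →L[ℂ] L2 (Γ × Γ) H} (hy : y ∈ cstarGen s) : y ∈ clSpan (mixed π α ω) :=
  cstarGen_le_of_subset_clSpan (fun _ hx _ hy => mul_mem_mixed hω hx hy)
    (fun _ hx => star_mem_mixed hω hx) hs hy

lemma Ad_regW_mem_clSpan_mixed (hπ : Function.Injective π) (hα : IsCoaction π α)
    (hω : IsCocycle ω) {T : L2 (Γ × Γ) H →L[ℂ] L2 (Γ × Γ) H} (hT : T ∈ braided α ω⁻¹) :
    regHom H ω⁻¹ T ∈ clSpan (mixed π α ω) :=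
  mem_clSpan_mixed_of_mem_cstarGen hω (regHom_braidedGens_subset hω hπ hα)
    (regHom_mem_cstarGen hT)

/-! ### Fixed points of the diagonal coaction as the component u = 1 -/

open Classical in
lemma coeff_mixed (g u : Γ) (a : A) (p q : Γ × Γ) :
    coeff p q (amplRight Γ (gen π ω g a) * ampl Γ (lam H ω⁻¹ u)) =
      if p.2 = u * q.2 then ((ω u q.2)⁻¹ : ℂ) • coeff p.1 q.1 (gen π ω g a) else 0 := by
  obtain ⟨k, l⟩ := p
  obtain ⟨k', l'⟩ := q
  ext v
  rw [coeff_apply, mixed_apply, ket_apply, smul_comm]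
  by_cases h : l = u * l'
  · subst h
    simp only [if_true, smul_apply, coeff_apply, gen_apply, ket_apply, inv_mul_cancel_left,
      Prod.mk.injEq, and_true, Circle.coe_inv]
  · have h' : ¬ u⁻¹ * l = l' := fun h' => h (by rw [← h', mul_inv_cancel_left])
    simp [h, h']

/-- Compression at δ_1 kills the terms with u ≠ 1 and returns λ^{(ω)}_g ⊗ a for u = 1. -/
lemma compress_mem_deformed' (hπ : Function.Injective π) {y : L2 (Γ × Γ) H →L[ℂ] L2 (Γ × Γ) H}
    (hω : IsCocycle ω) (hy : y ∈ clSpan (mixed π α ω)) : compress y ∈ deformed' π α ω := by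
  classical
  refine mem_deformed'_of_mem_clSpan hπ ?_
  refine map_mem_of_mem_clSpan compress (Submodule.isClosed_topologicalClosure _) ?_ hy
  rintro _ ⟨g, u, a, ha, rfl⟩
  by_cases hu : u = 1
  · have h : compress (amplRight Γ (gen π ω g a) * ampl Γ (lam H ω⁻¹ u)) = gen π ω g a := by
      refine ext_coeff fun k k' => ?_
      rw [coeff_compress, coeff_mixed]
      simp [hu, hω.one_left]
    rw [h]
    exact subset_clSpan _ ⟨g, a, ha, rfl⟩
  · have h : compress (amplRight Γ (gen π ω g a) * ampl Γ (lam H ω⁻¹ u)) = 0 := by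
      refine ext_coeff fun k k' => ?_
      rw [coeff_compress, coeff_mixed]
      simp [Ne.symm hu]
    rw [h]
    exact zero_mem _

/-- Only u = 1 contributes on the diagonal of the second leg, and there it acts as the identity. So
a block diagonal element is its compression tensored with 1. -/
lemma coeff_diagonal_of_mem_clSpan_mixed (hω : IsCocycle ω)
    {y : L2 (Γ × Γ) H →L[ℂ] L2 (Γ × Γ) H} (hy : y ∈ clSpan (mixed π α ω)) (k k' m : Γ) :
    coeff (k, m) (k', m) y = coeff (k, 1) (k', 1) y := by
  classical
  refine sub_eq_zero.1 ?_
  refine map_mem_of_mem_clSpan (N := ⊥)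
    ((coeff (k, m) (k', m) - coeff (k, 1) (k', 1) :
      (L2 (Γ × Γ) H →L[ℂ] L2 (Γ × Γ) H) →L[ℂ] (H →L[ℂ] H))) (by simp) ?_ hy
  rintro _ ⟨g, u, a, -, rfl⟩
  rw [sub_apply, coeff_mixed, coeff_mixed]
  by_cases hu : u = 1
  · simp [hu, hω.one_left]
  · simp [hu, Ne.symm hu]

/-- `Ad(W^{(conj ω)}_{13})` maps `A_ω` onto `A'_ω ⊗ 1`. -/
theorem image_deformed (hπ : Function.Injective π) (hα : IsCoaction π α) (hω : IsCocycle ω) :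
    Ad (regW ω⁻¹) '' (deformed α ω : Set _) = amplRight Γ '' deformed' π α ω := by
  classical
  apply Set.Subset.antisymm
  · rintro _ ⟨T, ⟨hT, hT'⟩, rfl⟩
    have hy := Ad_regW_mem_clSpan_mixed hπ hα hω hT
    refine ⟨_, compress_mem_deformed' hπ hω hy, ?_⟩
    rw [diagonalCoaction_eq_iff ω⁻¹] at hT'
    refine ext_coeff fun p q => ?_
    rw [coeff_amplRight, coeff_compress]
    split_ifs with h
    · rw [← coeff_diagonal_of_mem_clSpan_mixed hω hy _ _ p.2]
      nth_rw 2 [h]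
      rfl
    · exact (coeff_eq_zero_of_coact_snd_eq hT' h).symm
  · rintro _ ⟨x, hx, rfl⟩
    have hinv : ∀ S : L2 (Γ × Γ) H →L[ℂ] L2 (Γ × Γ) H,
        Ad (regW ω⁻¹) (Ad (regW ω⁻¹).symm S) = S := fun S => by
      ext ξ : 1
      simp
    refine ⟨Ad (regW ω⁻¹).symm (amplRight Γ x), ⟨?_, ?_⟩, hinv _⟩
    · refine hom_mem_of_mem_clSpan
        (((adHom (E := L2 (Γ × Γ) H) (F := L2 (Γ × Γ) H) (regW ω⁻¹).symm).comp
          (amplRightHom Γ H)))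
        (N := (braided α ω⁻¹).toSubmodule) (isClosed_cstarGen _) ?_
        ((mem_deformed'_iff_mem_clSpan hπ hα hω).1 hx)
      rintro _ ⟨g, a, ha, rfl⟩
      -- The extra factor λ^{(conj ω)}_g produced by conjugating α(a) is cancelled by its adjoint,
      -- leaving λ^{(ω)}_g ⊗ 1 ⊗ a.
      refine subset_cstarGen _ ⟨a, star (lam H ω⁻¹ g), star_mem (mem_twistedGroupAlg g), ?_⟩
      apply regHom_injective (ω := ω⁻¹)
      rw [mem_spectral.1 ha, map_mul, regHom_apply, regHom_apply, regHom_apply, Ad_regW_adTilde,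
        Ad_regW_amplRight_gen hω, mul_assoc, ← ampl_mul, lam_mul_star_lam]
      refine (hinv _).trans ?_
      ext ξ q
      rfl
    · rw [diagonalCoaction_eq_iff ω⁻¹, hinv, coact_snd_amplRight]

end Identification

/-! ### The isomorphisms of crossed products -/

section Crossed

variable {Γ : Type*} [Group Γ] {H : Type*} [NormedAddCommGroup H] [InnerProductSpace ℂ H]
  [CompleteSpace H] {A : Type*} [NonUnitalCStarAlgebra A] {ω : Γ → Γ → Circle}
  {π : A →⋆ₙₐ[ℂ] (H →L[ℂ] H)} {α : A →⋆ₙₐ[ℂ] (L2 Γ H →L[ℂ] L2 Γ H)}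

/-- The homomorphism `leg₁₂`. -/
def leg₁₂Hom (Γ H : Type*) [Group Γ] [NormedAddCommGroup H] [InnerProductSpace ℂ H]
    [CompleteSpace H] :
    (L2 (Γ × Γ) H →L[ℂ] L2 (Γ × Γ) H) →⋆ₙₐ[ℂ] (L2 (Γ × Γ × Γ) H →L[ℂ] L2 (Γ × Γ × Γ) H) :=
  legHom
    { toFun := fun q : Γ × Γ × Γ => (q.2.1, q.2.2, q.1)
      invFun := fun q => (q.2.2, q.1, q.2.1)
      left_inv := fun _ => rfl
      right_inv := fun _ => rfl }

@[simp] lemma leg₁₂Hom_apply (T : L2 (Γ × Γ) H →L[ℂ] L2 (Γ × Γ) H) :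
    leg₁₂Hom Γ H T = leg₁₂ T := rfl

lemma leg₁₂Hom_injective : Function.Injective (leg₁₂Hom Γ H) := legHom_injective _

lemma amplRightHom_injective : Function.Injective (amplRightHom Γ H) := legHom_injective _

/-- The coaction on `A'_ω` as a homomorphism. -/
def coactIdHom (Γ H : Type*) [Group Γ] [NormedAddCommGroup H] [InnerProductSpace ℂ H]
    [CompleteSpace H] :
    (L2 Γ H →L[ℂ] L2 Γ H) →⋆ₙₐ[ℂ] (L2 (Γ × Γ) H →L[ℂ] L2 (Γ × Γ) H) :=
  coactHom id

@[simp] lemma coactIdHom_apply (T : L2 Γ H →L[ℂ] L2 Γ H) : coactIdHom Γ H T = coact id T := rfl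

/-- Conjugation by `1 ⊗ W^{(ω)}` as a homomorphism. -/
def amplRegHom (H : Type*) [NormedAddCommGroup H] [InnerProductSpace ℂ H] [CompleteSpace H]
    (ω : Γ → Γ → Circle) :
    (L2 (Γ × Γ × Γ) H →L[ℂ] L2 (Γ × Γ × Γ) H) →⋆ₙₐ[ℂ]
      (L2 (Γ × Γ × Γ) H →L[ℂ] L2 (Γ × Γ × Γ) H) :=
  adHom (amplU Γ (regW ω))

@[simp] lemma amplRegHom_apply (ω : Γ → Γ → Circle)
    (T : L2 (Γ × Γ × Γ) H →L[ℂ] L2 (Γ × Γ × Γ) H) :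
    amplRegHom H ω T = Ad (amplU Γ (regW ω)) T := rfl

lemma amplRegHom_injective : Function.Injective (amplRegHom H ω) :=
  adHom_injective (E := L2 (Γ × Γ × Γ) H) (F := L2 (Γ × Γ × Γ) H) _

/-- Conjugation by `V` as a homomorphism. -/
def diagHom (H : Type*) [NormedAddCommGroup H] [InnerProductSpace ℂ H] [CompleteSpace H]
    (ω : Γ → Γ → Circle) :
    (L2 (Γ × Γ) H →L[ℂ] L2 (Γ × Γ) H) →⋆ₙₐ[ℂ] (L2 (Γ × Γ) H →L[ℂ] L2 (Γ × Γ) H) :=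
  adHom (diagV ω)

lemma diagHom_injective : Function.Injective (diagHom H ω) :=
  adHom_injective (E := L2 (Γ × Γ) H) (F := L2 (Γ × Γ) H) _

-- Both sides are supported where j⁻¹k = j'⁻¹k', with coefficients T_{jj'} and T_{kk'}. These agree,
-- since (k, k') is (j, j') translated on the right by j⁻¹k.
omit [CompleteSpace H] in
lemma Ad_regW_one_amplRight {T : L2 Γ H →L[ℂ] L2 Γ H}
    (hT : ∀ i j u : Γ, coeff (i * u) (j * u) T = coeff i j T) :
    Ad (regW 1) (amplRight Γ T) = coact id T := by
  classical
  refine ext_coeff fun p q => ?_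
  obtain ⟨j, k⟩ := p
  obtain ⟨j', k'⟩ := q
  rw [regW, coeff_Ad_mono, coeff_amplRight, coeff_coact]
  simp only [Pi.one_apply, Circle.coe_one, inv_one, mul_one, one_smul, id]
  have h : j⁻¹ * k = j'⁻¹ * k' ↔ k⁻¹ * j = k'⁻¹ * j' := by
    rw [← inv_inj]
    simp
  by_cases h' : j⁻¹ * k = j'⁻¹ * k'
  · have hk : k = j * (j⁻¹ * k) := by simp
    have hk' : k' = j' * (j⁻¹ * k) := by simp [h']
    refine (if_pos h').trans (Eq.trans ?_ (if_pos (h.1 h')).symm)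
    conv_rhs => rw [hk, hk']
    exact (hT j j' _).symm
  · exact (if_neg h').trans (if_neg (mt h.2 h')).symm

omit [CompleteSpace H] in
lemma Ad_amplU_regW_apply (ω : Γ → Γ → Circle) (T : L2 (Γ × Γ × Γ) H →L[ℂ] L2 (Γ × Γ × Γ) H)
    (ξ : L2 (Γ × Γ × Γ) H) (j k m : Γ) : Ad (amplU Γ (regW ω)) T ξ (j, k, m) =
      (ω k (k⁻¹ * m) : ℂ) • T ((amplU Γ (regW ω)).symm ξ) (j, k, k⁻¹ * m) := rfl

omit [CompleteSpace H] in
lemma amplU_regW_symm_apply (ω : Γ → Γ → Circle) (ξ : L2 (Γ × Γ × Γ) H) (j k m : Γ) :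
    (amplU Γ (regW ω)).symm ξ (j, k, m) = (ω k m : ℂ)⁻¹ • ξ (j, k, k * m) := rfl

variable [TopologicalSpace Γ]

omit [CompleteSpace H] in
lemma Ad_amplU_regW_mulC0 (ω : Γ → Γ → Circle) (f : C₀(Γ, ℂ)) :
    Ad (amplU Γ (regW ω)) (mulC0 (H := H) (Prod.fst : Γ × Γ × Γ → Γ) f) = mulC0 Prod.fst f := by
  ext ξ ⟨j, k, m⟩
  rw [Ad_amplU_regW_apply, mulC0_apply, mulC0_apply, amplU_regW_symm_apply, smul_comm,
    mul_inv_cancel_left, smul_smul (ω k _ : ℂ), mul_inv_cancel₀ (Circle.coe_ne_zero _), one_smul]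

omit [Group Γ] [CompleteSpace H] in
lemma leg₁₂_mulC0 (f : C₀(Γ, ℂ)) :
    leg₁₂ (mulC0 (H := H) (Prod.fst : Γ × Γ → Γ) f) = mulC0 Prod.fst f := by
  ext ξ ⟨j, k, m⟩
  simp [leg₁₂, leg]

omit [CompleteSpace H] in
lemma Ad_regW_amplRight_mulC0 (ω : Γ → Γ → Circle) (f : C₀(Γ, ℂ)) :
    Ad (regW ω) (amplRight Γ (mulC0 (H := H) id f)) = mulC0 Prod.fst f := by
  have h : amplRight Γ (mulC0 (H := H) id f) = mulC0 Prod.fst f := by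
    ext ξ ⟨j, k⟩
    simp [amplRight_apply]
  ext ξ ⟨j, k⟩
  rw [h, Ad_regW_apply, mulC0_apply, mulC0_apply, regW_symm_apply, smul_comm,
    mul_inv_cancel_left, smul_smul (ω j _ : ℂ), mul_inv_cancel₀ (Circle.coe_ne_zero _), one_smul]

/-! ### The isomorphism Θ -/

/-- The generators of a crossed product. -/
def crossedGens {I : Type*} (p : I → Γ) (S : Set (L2 I H →L[ℂ] L2 I H)) :
    Set (L2 I H →L[ℂ] L2 I H) :=
  {T | ∃ b ∈ S, ∃ f : C₀(Γ, ℂ), T = b * mulC0 p f}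

lemma crossedDeformed_eq (α : A →⋆ₙₐ[ℂ] (L2 Γ H →L[ℂ] L2 Γ H)) (ω : Γ → Γ → Circle) :
    crossedDeformed α ω = cstarGen (crossedGens (Prod.fst : Γ × Γ × Γ → Γ)
      (deformedCoaction '' (deformed α ω : Set (L2 (Γ × Γ) H →L[ℂ] L2 (Γ × Γ) H)))) := rfl

lemma crossedDeformed'_eq (ω : Γ → Γ → Circle) : crossedDeformed' π α ω =
    cstarGen (crossedGens Prod.fst (coact id '' deformed' π α ω)) := rfl

omit [Group Γ] in
lemma crossed_eq : crossed α = cstarGen (crossedGens id (Set.range α)) := rfl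

/-- The unitary 1 ⊗ W^{(ω)} commutes with C₀(Γ) on the new leg and intertwines the coactions, so the
identification of A_ω with A'_ω passes to crossed products. -/
lemma amplRegHom_generator {T : L2 (Γ × Γ) H →L[ℂ] L2 (Γ × Γ) H} {x : L2 Γ H →L[ℂ] L2 Γ H}
    (h : Ad (regW ω) T = amplRight Γ x) (f : C₀(Γ, ℂ)) :
    amplRegHom H ω (deformedCoaction T * mulC0 Prod.fst f) =
      leg₁₂Hom Γ H (coact id x * mulC0 Prod.fst f) := by
  rw [map_mul, map_mul, amplRegHom_apply, amplRegHom_apply, leg₁₂Hom_apply, leg₁₂Hom_apply,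
    Ad_amplU_regW_deformedCoaction, h, deformedCoaction_amplRight, Ad_amplU_regW_mulC0,
    leg₁₂_mulC0]

lemma image_crossedGens_deformed (hπ : Function.Injective π) (hα : IsCoaction π α)
    (hω : IsCocycle ω) :
    amplRegHom H ω⁻¹ '' crossedGens Prod.fst (deformedCoaction '' (deformed α ω : Set _)) =
      leg₁₂Hom Γ H '' crossedGens Prod.fst (coact id '' deformed' π α ω) := by
  have h := image_deformed hπ hα hω
  apply Set.Subset.antisymm
  · rintro _ ⟨_, ⟨_, ⟨T, hT, rfl⟩, f, rfl⟩, rfl⟩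
    obtain ⟨x, hx, hx'⟩ : Ad (regW ω⁻¹) T ∈ amplRight Γ '' deformed' π α ω := h ▸ ⟨T, hT, rfl⟩
    exact ⟨_, ⟨_, ⟨x, hx, rfl⟩, f, rfl⟩, (amplRegHom_generator hx'.symm f).symm⟩
  · rintro _ ⟨_, ⟨_, ⟨x, hx, rfl⟩, f, rfl⟩, rfl⟩
    obtain ⟨T, hT, hT'⟩ : amplRight Γ x ∈ Ad (regW ω⁻¹) '' (deformed α ω : Set _) :=
      h.symm ▸ ⟨x, hx, rfl⟩
    exact ⟨_, ⟨_, ⟨T, hT, rfl⟩, f, rfl⟩, amplRegHom_generator hT' f⟩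

lemma map_crossedDeformed (hπ : Function.Injective π) (hα : IsCoaction π α) (hω : IsCocycle ω) :
    (crossedDeformed α ω).map (amplRegHom H ω⁻¹) =
      (crossedDeformed' π α ω).map (leg₁₂Hom Γ H) := by
  rw [crossedDeformed_eq, crossedDeformed'_eq]
  have h := image_crossedGens_deformed hπ hα hω
  exact map_cstarGen_eq_map_cstarGen (amplRegHom H ω⁻¹) (leg₁₂Hom Γ H) amplRegHom_injective
    leg₁₂Hom_injective h

omit [TopologicalSpace Γ] in
lemma coact_gen_apply (ω : Γ → Γ → Circle) (g : Γ) (a : A) (ξ : L2 (Γ × Γ) H) (j k : Γ) :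
    coact id (gen π ω g a) ξ (j, k) = (ω g (g⁻¹ * k) : ℂ) • π a (ξ (g⁻¹ * j, g⁻¹ * k)) :=
  coact_lam ω g (π a) ξ j k

lemma mul_mulC0_mem_crossedDeformed' {x : L2 Γ H →L[ℂ] L2 Γ H} (hx : x ∈ deformed' π α ω)
    (f : C₀(Γ, ℂ)) : coactIdHom Γ H x * mulC0 Prod.fst f ∈ crossedDeformed' π α ω := by
  rw [crossedDeformed'_eq]
  exact subset_cstarGen _ ⟨_, ⟨x, hx, rfl⟩, f, rfl⟩

/-- To map the generators of `C₀(Γ) ⋉ A'_ω` into a `C*`-algebra it suffices to consider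
homogeneous elements. -/
lemma crossedDeformed'_le {N : NonUnitalStarSubalgebra ℂ (L2 (Γ × Γ) H →L[ℂ] L2 (Γ × Γ) H)}
    (hπ : Function.Injective π) (hα : IsCoaction π α) (hω : IsCocycle ω)
    (hN : IsClosed (N : Set (L2 (Γ × Γ) H →L[ℂ] L2 (Γ × Γ) H)))
    (h : ∀ g, ∀ a ∈ spectral π α g, ∀ f : C₀(Γ, ℂ),
      coactIdHom Γ H (gen π ω g a) * mulC0 Prod.fst f ∈ N) : crossedDeformed' π α ω ≤ N := by
  rw [crossedDeformed'_eq]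
  refine cstarGen_le hN ?_
  rintro _ ⟨_, ⟨x, hx, rfl⟩, f, rfl⟩
  refine map_mem_of_mem_clSpan (N := N.toSubmodule)
    (((ContinuousLinearMap.mul ℂ (L2 (Γ × Γ) H →L[ℂ] L2 (Γ × Γ) H)).flip
      (mulC0 Prod.fst f)).comp (toCLM (coactIdHom Γ H))) hN ?_
    ((mem_deformed'_iff_mem_clSpan hπ hα hω).1 hx)
  rintro _ ⟨g, a, ha, rfl⟩
  exact h g a ha f

/-! ### The isomorphism Φ: untwisting by V -/

variable [DiscreteTopology Γ]

/-- Multiplication of a function vanishing at infinity by a `U(1)`-valued function. -/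
def phaseMul (c : Γ → Circle) (f : C₀(Γ, ℂ)) : C₀(Γ, ℂ) where
  toFun k := c k * f k
  continuous_toFun := continuous_of_discreteTopology
  zero_at_infty' := by
    rw [tendsto_zero_iff_norm_tendsto_zero]
    simpa [Circle.norm_coe] using tendsto_zero_iff_norm_tendsto_zero.1 f.zero_at_infty'

omit [Group Γ] in
@[simp] lemma phaseMul_apply (c : Γ → Circle) (f : C₀(Γ, ℂ)) (k : Γ) :
    phaseMul c f k = c k * f k := rfl

omit [Group Γ] in
lemma phaseMul_phaseMul_inv (c : Γ → Circle) (f : C₀(Γ, ℂ)) :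
    phaseMul c (phaseMul c⁻¹ f) = f := by
  ext k
  simp

omit [CompleteSpace H] [TopologicalSpace Γ] [DiscreteTopology Γ] in
lemma Ad_diagV_apply (ω : Γ → Γ → Circle) (T : L2 (Γ × Γ) H →L[ℂ] L2 (Γ × Γ) H)
    (ξ : L2 (Γ × Γ) H) (j k : Γ) : Ad (diagV ω) T ξ (j, k) =
      (((ω j⁻¹ j)⁻¹ * ω j⁻¹ k : Circle) : ℂ) • T ((diagV ω).symm ξ) (j, k) := rfl

omit [CompleteSpace H] [TopologicalSpace Γ] [DiscreteTopology Γ] in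
lemma diagV_symm_apply (ω : Γ → Γ → Circle) (ξ : L2 (Γ × Γ) H) (j k : Γ) :
    (diagV ω).symm ξ (j, k) = (((ω j⁻¹ j)⁻¹ * ω j⁻¹ k : Circle) : ℂ)⁻¹ • ξ (j, k) := rfl

-- Two instances of the cocycle identity, for ((gh)⁻¹, g, m) and ((gh)⁻¹, g, h). In terms of the
-- phases of V this reads V(gh, gm) ω(g, m) V(h, m)⁻¹ = ω(g, h): the result no longer depends on m.
omit [TopologicalSpace Γ] [DiscreteTopology Γ] in
lemma diagV_phase (hω : IsCocycle ω) (g h m : Γ) :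
    (ω (g * h)⁻¹ (g * h))⁻¹ * ω (g * h)⁻¹ (g * m) * ω g m =
      ω g h * ((ω h⁻¹ h)⁻¹ * ω h⁻¹ m) := by
  have h1 := hω.cocycle (g * h)⁻¹ g m
  have h2 := hω.cocycle (g * h)⁻¹ g h
  have h3 : (g * h)⁻¹ * g = h⁻¹ := by group
  rw [h3] at h1 h2
  have h4 : ω (g * h)⁻¹ g = ω g h * ω (g * h)⁻¹ (g * h) * (ω h⁻¹ h)⁻¹ := by
    rw [← h2, mul_inv_cancel_right]
  rw [mul_assoc, mul_comm (ω _ (g * m)), ← h1, h4, ← mul_assoc, mul_comm _⁻¹, mul_assoc (ω g h),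
    mul_comm (ω (g * h)⁻¹ _), ← mul_assoc, mul_inv_cancel_right, mul_assoc]

/-- The twist on the second leg becomes multiplication by ω(g, ·) on the first. It acts before the
shift by g and so combines with f. -/
lemma Ad_diagV_generator (hω : IsCocycle ω) (g : Γ) (a : A) (f : C₀(Γ, ℂ)) :
    Ad (diagV ω) (coact id (gen π ω g a) * mulC0 Prod.fst f) =
      coact id (gen π 1 g a) * mulC0 Prod.fst (phaseMul (ω g) f) := by
  ext ξ ⟨j, k⟩
  have h := diagV_phase hω g (g⁻¹ * j) (g⁻¹ * k)
  rw [mul_inv_cancel_left, mul_inv_cancel_left] at h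
  rw [Ad_diagV_apply, op_mul_apply, op_mul_apply, coact_gen_apply, coact_gen_apply, mulC0_apply,
    mulC0_apply, diagV_symm_apply, map_smul, map_smul, map_smul, smul_smul, ← Circle.coe_mul, h,
    smul_smul, smul_smul, smul_smul, phaseMul_apply]
  congr 1
  simp only [Circle.coe_mul, Circle.coe_inv, Pi.one_apply, Circle.coe_one, one_mul]
  field_simp

lemma diagHom_generator (hω : IsCocycle ω) (g : Γ) (a : A) (f : C₀(Γ, ℂ)) :
    diagHom H ω (coactIdHom Γ H (gen π ω g a) * mulC0 Prod.fst f) =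
      coactIdHom Γ H (gen π 1 g a) * mulC0 Prod.fst (phaseMul (ω g) f) :=
  Ad_diagV_generator hω g a f

omit [DiscreteTopology Γ] in
lemma isClosed_crossedDeformed' (ω : Γ → Γ → Circle) :
    IsClosed (crossedDeformed' π α ω : Set (L2 (Γ × Γ) H →L[ℂ] L2 (Γ × Γ) H)) :=
  isClosed_cstarGen _

lemma map_crossedDeformed'_le (hπ : Function.Injective π) (hα : IsCoaction π α)
    (hω : IsCocycle ω) :
    crossedDeformed' π α ω ≤ (crossedDeformed' π α 1).comap (diagHom H ω) := by
  refine crossedDeformed'_le hπ hα hω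
    ((isClosed_crossedDeformed' 1).preimage (toCLM (diagHom H ω)).continuous) fun g a ha f => ?_
  rw [NonUnitalStarSubalgebra.mem_comap, diagHom_generator hω]
  exact mul_mulC0_mem_crossedDeformed' (gen_mem_deformed' hπ ha) _

omit [DiscreteTopology Γ] in
lemma isClosed_map_crossedDeformed' (ω : Γ → Γ → Circle) :
    IsClosed ((crossedDeformed' π α ω).map (diagHom H ω) :
      Set (L2 (Γ × Γ) H →L[ℂ] L2 (Γ × Γ) H)) := by
  rw [crossedDeformed'_eq]
  exact isClosed_map_cstarGen (diagHom H ω) diagHom_injective _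

lemma le_map_crossedDeformed' (hπ : Function.Injective π) (hα : IsCoaction π α)
    (hω : IsCocycle ω) :
    crossedDeformed' π α 1 ≤ (crossedDeformed' π α ω).map (diagHom H ω) := by
  refine crossedDeformed'_le hπ hα isCocycle_one
    (isClosed_map_crossedDeformed' ω) fun g a ha f => ?_
  -- The preimage carries the inverse phase on f, cancelling the one that Ad(V) creates.
  refine mem_map_of_eq (diagHom H ω)
    (mul_mulC0_mem_crossedDeformed' (gen_mem_deformed' hπ ha) (phaseMul (ω g)⁻¹ f)) ?_
  rw [diagHom_generator hω, phaseMul_phaseMul_inv]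

lemma map_crossedDeformed' (hπ : Function.Injective π) (hα : IsCoaction π α)
    (hω : IsCocycle ω) :
    (crossedDeformed' π α ω).map (diagHom H ω) = crossedDeformed' π α 1 :=
  le_antisymm (NonUnitalStarSubalgebra.map_le.2 (map_crossedDeformed'_le hπ hα hω))
    (le_map_crossedDeformed' hπ hα hω)

/-! ### The isomorphism Ψ and the three equivalences -/

/-- The homomorphism `x ↦ W (x ⊗ 1) W*`. -/
def regAmplHom (Γ H : Type*) [Group Γ] [NormedAddCommGroup H] [InnerProductSpace ℂ H]
    [CompleteSpace H] :
    (L2 Γ H →L[ℂ] L2 Γ H) →⋆ₙₐ[ℂ] (L2 (Γ × Γ) H →L[ℂ] L2 (Γ × Γ) H) :=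
  (regHom H 1).comp (amplRightHom Γ H)

omit [TopologicalSpace Γ] [DiscreteTopology Γ] in
lemma regAmplHom_apply (T : L2 Γ H →L[ℂ] L2 Γ H) :
    regAmplHom Γ H T = Ad (regW 1) (amplRight Γ T) := rfl

omit [TopologicalSpace Γ] [DiscreteTopology Γ] in
lemma regAmplHom_injective : Function.Injective (regAmplHom Γ H) :=
  regHom_injective.comp amplRightHom_injective

omit [DiscreteTopology Γ] in
lemma regAmplHom_generator (hα : IsCoaction π α) (a : A) (f : C₀(Γ, ℂ)) :
    regAmplHom Γ H (α a * mulC0 id f) = coactIdHom Γ H (α a) * mulC0 Prod.fst f := by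
  rw [map_mul, regAmplHom_apply, regAmplHom_apply, Ad_regW_amplRight_mulC0,
    Ad_regW_one_amplRight (coeff_mul_right_of_mem_tensor π (hα.mem_tensor a)), coactIdHom_apply]

omit [DiscreteTopology Γ] in
lemma map_crossed_le (hα : IsCoaction π α) :
    (crossed α).map (regAmplHom Γ H) ≤ crossedDeformed' π α 1 := by
  rw [crossed_eq]
  refine map_cstarGen_le _ regAmplHom_injective (isClosed_crossedDeformed' 1) ?_
  rintro _ ⟨_, ⟨a, rfl⟩, f, rfl⟩
  rw [regAmplHom_generator hα]
  exact mul_mulC0_mem_crossedDeformed' (hα.mem_deformed' a) f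

omit [DiscreteTopology Γ] in
lemma le_map_crossed (hπ : Function.Injective π) (hα : IsCoaction π α) :
    crossedDeformed' π α 1 ≤ (crossed α).map (regAmplHom Γ H) := by
  rw [crossed_eq]
  refine crossedDeformed'_le hπ hα isCocycle_one
    (isClosed_map_cstarGen _ regAmplHom_injective _) fun g a ha f => ?_
  -- For a of degree g the generator λ_g ⊗ a of A'_1 is α(a) itself, so homogeneous generators
  -- already come from C₀(Γ) ⋉ A.
  rw [← mem_spectral.1 ha, ← regAmplHom_generator hα, NonUnitalStarSubalgebra.mem_map]
  exact ⟨_, subset_cstarGen _ ⟨_, ⟨a, rfl⟩, f, rfl⟩, rfl⟩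

omit [DiscreteTopology Γ] in
lemma exists_equiv_theta (hπ : Function.Injective π) (hα : IsCoaction π α) (hω : IsCocycle ω) :
    ∃ Θ : crossedDeformed α ω ≃⋆ₐ[ℂ] crossedDeformed' π α ω,
      ∀ y, Ad (amplU Γ (regW ω⁻¹)) y.1 = leg₁₂ (Θ y).1 :=
  exists_starAlgEquiv (amplRegHom H ω⁻¹) (leg₁₂Hom Γ H) amplRegHom_injective
    leg₁₂Hom_injective _ _ (map_crossedDeformed hπ hα hω)

lemma exists_equiv_phi (hπ : Function.Injective π) (hα : IsCoaction π α) (hω : IsCocycle ω) :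
    ∃ Φ : crossedDeformed' π α ω ≃⋆ₐ[ℂ] crossedDeformed' π α 1,
      ∀ y, (Φ y).1 = Ad (diagV ω) y.1 := by
  obtain ⟨Φ, hΦ⟩ := exists_starAlgEquiv_of_map_eq (diagHom H ω) diagHom_injective
    (map_crossedDeformed' (ω := ω) hπ hα hω)
  exact ⟨Φ, fun y => (hΦ y).symm⟩

omit [DiscreteTopology Γ] in
lemma exists_equiv_psi (hπ : Function.Injective π) (hα : IsCoaction π α) :
    ∃ Ψ : crossedDeformed' π α 1 ≃⋆ₐ[ℂ] crossed α,
      ∀ y, y.1 = Ad (regW 1) (amplRight Γ (Ψ y).1) := by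
  exact exists_starAlgEquiv_of_eq_map (regAmplHom Γ H) regAmplHom_injective
    (le_antisymm (map_crossed_le hα) (le_map_crossed hπ hα))

end Crossed

/-! ### The composition -/

lemma exists_trans_starAlgEquiv {S T U X : Type*} [Add S] [Mul S] [Star S] [SMul ℂ S]
    [Add T] [Mul T] [Star T] [SMul ℂ T] [Add U] [Mul U] [Star U] [SMul ℂ U]
    [Add X] [Mul X] [Star X] [SMul ℂ X] {p : (S ≃⋆ₐ[ℂ] T) → Prop} {q : (T ≃⋆ₐ[ℂ] U) → Prop}
    {r : (U ≃⋆ₐ[ℂ] X) → Prop} (hp : ∃ Θ, p Θ) (hq : ∃ Φ, q Φ) (hr : ∃ Ψ, r Ψ) :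
    ∃ (Ξ : S ≃⋆ₐ[ℂ] X) (Θ : S ≃⋆ₐ[ℂ] T) (Φ : T ≃⋆ₐ[ℂ] U) (Ψ : U ≃⋆ₐ[ℂ] X),
      Ξ = (Θ.trans Φ).trans Ψ ∧ p Θ ∧ q Φ ∧ r Ψ := by
  obtain ⟨Θ, hΘ⟩ := hp
  obtain ⟨Φ, hΦ⟩ := hq
  obtain ⟨Ψ, hΨ⟩ := hr
  exact ⟨_, Θ, Φ, Ψ, rfl, hΘ, hΦ, hΨ⟩

end CocycleDeformation
end

set_option maxHeartbeats 2000000 in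
theorem mainTheorem5 {Γ : Type*} [Group Γ] [TopologicalSpace Γ] [DiscreteTopology Γ]
    {A : Type*} [NonUnitalCStarAlgebra A]
    {H : Type*} [NormedAddCommGroup H] [InnerProductSpace ℂ H] [CompleteSpace H]
    (π : A →⋆ₙₐ[ℂ] (H →L[ℂ] H)) (hπ : Function.Injective π)
    (α : A →⋆ₙₐ[ℂ] (L2 Γ H →L[ℂ] L2 Γ H)) (hα : IsCoaction π α)
    (ω : Γ → Γ → Circle) (hω : IsCocycle ω) :
    -- the identification of `A_ω` with `A'_ω` through `W^{(conj ω)}_{13}`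
    Ad (regW ω⁻¹) '' (deformed α ω : Set _) = amplRight Γ '' deformed' π α ω ∧
    ∃ (Ξ : crossedDeformed α ω ≃⋆ₐ[ℂ] crossed α)
      (Θ : crossedDeformed α ω ≃⋆ₐ[ℂ] crossedDeformed' π α ω)
      (Φ : crossedDeformed' π α ω ≃⋆ₐ[ℂ] crossedDeformed' π α 1)
      (Ψ : crossedDeformed' π α 1 ≃⋆ₐ[ℂ] crossed α),
      Ξ = (Θ.trans Φ).trans Ψ ∧
      -- `Θ` is induced by the identification of `A_ω` with `A'_ω`
      (∀ y, Ad (amplU Γ (regW ω⁻¹)) y.1 = leg₁₂ (Θ y).1) ∧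
      -- `Φ = Ad V_{12}`
      (∀ y, (Φ y).1 = Ad (diagV ω) y.1) ∧
      -- `Ψ` is induced by the identification of `α(A)` with `A'_1` through `W`
      (∀ y, y.1 = Ad (regW 1) (amplRight Γ (Ψ y).1)) := by
  exact ⟨image_deformed hπ hα hω, exists_trans_starAlgEquiv
    (exists_equiv_theta hπ hα hω) (exists_equiv_phi hπ hα hω) (exists_equiv_psi hπ hα)⟩
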